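/- Let $p$ be a prime and let $R$ be a discrete valuation ring whose field of fractions $K$ has characteristic $0$ and whose residue field $k$ has characteristic $p$. Let $\delta\in R$, with image $\bar\delta\in k$, and let $n\ge 0$. For a field $F$ and $d\in F$ let $B_n^F(d)$ be the Brauer algebra, with basis the Brauer diagrams with two rows of $n$ nodes and with the product of two diagrams equal to $d^{t}$ times their concatenation with its $t$ closed loops removed. For a partition $\lambda$ of one of $n,n-2,n-4,\dots\ge 0$ let $\Delta_n^F(\lambda)=V_t\otimes S^\lambda_F$ be the corresponding cell module, where $|\lambda|=n-2t$, $V_t$ has as basis the partial diagrams on $n$ nodes with $t$ edges, and $S^\lambda_F$ is the Specht module. A diagram $x$ acts by $x(v\otimes s)=d^{j}\,(xv)\otimes\sigma(x,v)s$ if the concatenation $xv$ has exactly $t$ edges, and by $0$ otherwise, where $j$ is the number of closed loops and $\sigma(x,v)$ is the induced permutation of the free nodes. Let $\mathcal B_n^F(\lambda)$ be the set of all such partitions $\mu$ for which $\Delta_n^F(\mu)$ lies in the same block of the algebra (indecomposable two-sided direct summand) as $\Delta_n^F(\lambda)$, the parameter being $d=\delta$ for $F=K$ and $d=\bar\delta$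 for $F=k$. If $\mu\in\mathcal B_n^K(\lambda)$, then $\mu\in\mathcal B_n^k(\lambda)$. -/

import Mathlib

noncomputable section

namespace Brauer

open Function

/-! ### Generalities on equivalence relations -/

theorem map_le {α β : Type} {r : Setoid α} {f : α → β} {s : Setoid β} :
    r.map f ≤ s ↔ ∀ a b, r a b → s (f a) (f b) := by
  constructor
  · intro h a b hab
    exact h (Setoid.le_comap_map hab)
  · intro h
    refine Setoid.eqvGen_le ?_
    rintro _ _ ⟨a, b, hab, rfl, rfl⟩
    exact h a b hab

/-- The number of classes of `s` that contain no element of the form `o a`. -/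
def innerCount {V A : Type} (s : Setoid V) (o : A → V) : ℕ :=
  Nat.card {c : Quotient s // ∀ a, c ≠ Quotient.mk s (o a)}

/-- Eliminating the part `V₀` of a glued equivalence relation. -/
theorem elim_aux {A A' V₀ V W : Type} [Finite V] [Finite W] [Finite V₀]
    (J : Setoid V₀) (K : Setoid W) (o : A → V₀) (i : A → W) (f : V₀ → V) (g : W → V)
    (hfg : ∀ a, f (o a) = g (i a)) (hsurj : ∀ v, (∃ u, f u = v) ∨ ∃ w, g w = v)
    (hpush : ∀ (Q : Type) (φ₀ : V₀ → Q) (φ₁ : W → Q), (∀ a, φ₀ (o a) = φ₁ (i a)) →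
      ∃ φ : V → Q, (∀ u, φ (f u) = φ₀ u) ∧ ∀ w, φ (g w) = φ₁ w)
    (o' : A' → W) :
    (∀ w w', (J.map f ⊔ K.map g) (g w) (g w') ↔ ((J.comap o).map i ⊔ K) w w') ∧
    innerCount (J.map f ⊔ K.map g) (g ∘ o') =
      innerCount J o + innerCount ((J.comap o).map i ⊔ K) o' := by
  classical
  set R := J.map f ⊔ K.map g with hR
  set J' := (J.comap o).map i ⊔ K with hJ'
  let Q := Quotient J' ⊕ {c : Quotient J // ∀ a, c ≠ Quotient.mk J (o a)}
  let φ₀ : V₀ → Q := fun u => if h : ∃ a, J (o a) u then .inl (Quotient.mk J' (i h.choose))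
    else .inr ⟨Quotient.mk J u, fun a ha => h ⟨a, Quotient.exact ha.symm⟩⟩
  have hii : ∀ a b, J (o a) (o b) → J' (i a) (i b) := fun a b hab =>
    (le_sup_left : (J.comap o).map i ≤ J') (Setoid.le_comap_map (r := J.comap o) hab)
  have h₀ : ∀ a u, J (o a) u → φ₀ u = .inl (Quotient.mk J' (i a)) := by
    intro a u hau
    have h : ∃ a, J (o a) u := ⟨a, hau⟩
    simp only [φ₀, dif_pos h]
    congr 1
    exact Quotient.sound (hii _ _ (J.trans h.choose_spec (J.symm hau)))
  have h₀' : ∀ u (h : ∀ a, ¬ J (o a) u), φ₀ u =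
      .inr ⟨Quotient.mk J u, fun a ha => h a (Quotient.exact ha.symm)⟩ := by
    intro u hu
    have h : ¬ ∃ a, J (o a) u := by push Not; exact hu
    simp only [φ₀, dif_neg h]
  have hJφ : ∀ u v, J u v → φ₀ u = φ₀ v := by
    intro u v huv
    by_cases h : ∃ a, J (o a) u
    · obtain ⟨a, ha⟩ := h
      rw [h₀ a u ha, h₀ a v (J.trans ha huv)]
    · push Not at h
      rw [h₀' u h, h₀' v (fun a ha => h a (J.trans ha (J.symm huv)))]
      congr 2
      exact Quotient.sound huv
  obtain ⟨φ, hφ0, hφ1⟩ := hpush Q φ₀ (fun w => .inl (Quotient.mk J' w))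
    (fun a => h₀ a _ (J.refl _))
  have hRφ : R ≤ Setoid.ker φ := by
    refine sup_le (map_le.2 ?_) (map_le.2 ?_)
    · intro a b hab
      rw [Setoid.ker_def, hφ0, hφ0]
      exact hJφ _ _ hab
    · intro a b hab
      rw [Setoid.ker_def, hφ1, hφ1]
      congr 1
      exact Quotient.sound ((le_sup_right : K ≤ J') hab)
  have hJR : ∀ u v, J u v → R (f u) (f v) := fun u v h =>
    (le_sup_left : J.map f ≤ R) (Setoid.le_comap_map h)
  have hJ'R : J' ≤ R.comap g := by
    refine sup_le (map_le.2 ?_) ?_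
    · intro a b hab
      rw [Setoid.comap_rel, ← hfg, ← hfg]
      exact hJR _ _ hab
    · intro a b hab
      exact (le_sup_right : K.map g ≤ R) (Setoid.le_comap_map hab)
  refine ⟨fun w w' => ⟨fun h => ?_, fun h => hJ'R h⟩, ?_⟩
  · have := hRφ h
    rw [Setoid.ker_def, hφ1, hφ1] at this
    exact Quotient.exact (Sum.inl_injective this)
  · let e : Quotient R ≃ Q :=
      { toFun := Quotient.lift φ (fun a b h => hRφ h)
        invFun := Sum.elim (Quotient.map g (fun a b h => hJ'R h))
          (fun c => Quotient.map f (fun a b h => hJR a b h) c.1)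
        left_inv := by
          intro c
          induction c using Quotient.ind with | _ v
          simp only [Quotient.lift_mk]
          obtain ⟨u, rfl⟩ | ⟨w, rfl⟩ := hsurj v
          · rw [hφ0]
            by_cases h : ∃ a, J (o a) u
            · obtain ⟨a, ha⟩ := h
              rw [h₀ a u ha]
              simp only [Sum.elim_inl, Quotient.map_mk]
              rw [← hfg]
              exact Quotient.sound (hJR _ _ ha)
            · push Not at h
              rw [h₀' u h]
              simp
          · rw [hφ1]
            simp
        right_inv := by
          rintro (c | ⟨c, hc⟩)
          · induction c using Quotient.ind with | _ w
            simp [hφ1]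
          · induction c using Quotient.ind with | _ u
            simp only [Sum.elim_inr, Quotient.map_mk, Quotient.lift_mk, hφ0]
            rw [h₀' u (fun a ha => hc a (Quotient.sound ha).symm)] }
    have e1 : {c : Quotient R // ∀ a, c ≠ Quotient.mk R ((g ∘ o') a)} ≃
        {c : Q // ∀ a, c ≠ .inl (Quotient.mk J' (o' a))} := by
      refine e.subtypeEquiv ?_
      intro c
      refine forall_congr' fun a => ?_
      have : e (Quotient.mk R ((g ∘ o') a)) = .inl (Quotient.mk J' (o' a)) := by
        simp [e, hφ1]
      rw [← this, Ne, Ne, e.apply_eq_iff_eq]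
    unfold innerCount
    rw [Nat.card_congr (e1.trans Equiv.subtypeSum), Nat.card_sum, add_comm]
    congr 1
    · exact Nat.card_congr (Equiv.subtypeUnivEquiv (by simp))
    · refine Nat.card_congr (Equiv.subtypeEquivRight fun c => ?_)
      exact forall_congr' fun a => not_congr Sum.inl_injective.eq_iff

/-- Two involutions: an orbit that contains a fixed point contains exactly one further one. -/
theorem dihedral {V : Type} [Finite V] (X Y : Equiv.Perm V) (hX : ∀ v, X (X v) = v)
    (hY : ∀ v, Y (Y v) = v) (a : V) (ha : Y a = a) (ha' : X a ≠ a) (s : Setoid V)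
    (hs : ∀ t : Setoid V, s ≤ t ↔ (∀ v, t v (X v)) ∧ ∀ v, t v (Y v)) :
    ∃! b, b ≠ a ∧ s a b ∧ (X b = b ∨ Y b = b) := by
  obtain ⟨hsX, hsY⟩ := (hs s).1 le_rfl
  set r : Equiv.Perm V := X * Y with hr
  have hXX : X * X = 1 := Equiv.ext hX
  have hYY : Y * Y = 1 := Equiv.ext hY
  have hYi : Y⁻¹ = Y := inv_eq_of_mul_eq_one_left hYY
  have hXi : X⁻¹ = X := inv_eq_of_mul_eq_one_left hXX
  have hri : Y * r * Y⁻¹ = r⁻¹ := by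
    rw [hr, mul_inv_rev, hYi, hXi, mul_assoc Y, mul_assoc X, hYY, mul_one]
  have hYr : ∀ k : ℤ, Y * r ^ k = r ^ (-k) * Y := by
    intro k
    have : (Y * r * Y⁻¹) ^ k = r ^ (-k) := by rw [hri, inv_zpow, zpow_neg]
    rw [conj_zpow] at this
    rw [← this, mul_assoc, inv_mul_cancel, mul_one]
  have hYk : ∀ k : ℤ, Y ((r ^ k) a) = (r ^ (-k)) a := by
    intro k
    have := congrArg (fun e : Equiv.Perm V => e a) (hYr k)
    simpa [ha] using this
  have hXrY : X = r * Y := by rw [hr, mul_assoc, hYY, mul_one]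
  have hXk : ∀ k : ℤ, X ((r ^ k) a) = (r ^ (1 - k)) a := by
    intro k
    have h1 : X ((r ^ k) a) = r (Y ((r ^ k) a)) := by rw [hr, Equiv.Perm.mul_apply, hY]
    rw [h1, hYk, sub_eq_add_neg, zpow_add, zpow_one, Equiv.Perm.mul_apply]
    rfl
  set m : ℕ := minimalPeriod (r • ·) a with hm
  have hmpos : 0 < m := by
    apply minimalPeriod_pos_of_mem_periodicPts
    have : Injective (fun v : V => r • v) := MulAction.injective r
    exact this.mem_periodicPts a
  have hdvd : ∀ k l : ℤ, (r ^ k) a = (r ^ l) a ↔ (m : ℤ) ∣ k - l := by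
    intro k l
    rw [hm, ← MulAction.zpow_smul_eq_iff_minimalPeriod_dvd, sub_eq_neg_add, zpow_add, mul_smul,
      zpow_neg, inv_smul_eq_iff]
    rfl
  have hsr : ∀ k : ℤ, s a ((r ^ k) a) := by
    have h1 : ∀ v, s v (r v) := fun v => s.trans (hsY v) (hsX (Y v))
    have h2 : ∀ v, s v (r⁻¹ v) := fun v => s.symm (by simpa using h1 (r⁻¹ v))
    intro k
    induction k using Int.induction_on with
    | zero => exact s.refl _
    | succ k ih => rw [add_comm, zpow_add, zpow_one]; exact s.trans ih (h1 _)
    | pred k ih =>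
      rw [sub_eq_add_neg, add_comm, zpow_add, zpow_neg_one]; exact s.trans ih (h2 _)
  have horb : ∀ b, s a b → ∃ k : ℤ, b = (r ^ k) a := by
    let P : V → Prop := fun b => ∃ k : ℤ, b = (r ^ k) a
    have hPX : ∀ v, P v → P (X v) := by
      rintro _ ⟨k, rfl⟩
      exact ⟨_, hXk k⟩
    have hPY : ∀ v, P v → P (Y v) := by
      rintro _ ⟨k, rfl⟩
      exact ⟨_, hYk k⟩
    have : s ≤ Setoid.ker P := by
      rw [hs]
      refine ⟨fun v => ?_, fun v => ?_⟩
      · exact propext ⟨hPX v, fun h => by simpa [hX] using hPX _ h⟩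
      · exact propext ⟨hPY v, fun h => by simpa [hY] using hPY _ h⟩
    intro b hb
    have h := this hb
    rw [Setoid.ker_def] at h
    have hPa : P a := ⟨0, by simp⟩
    exact (h ▸ hPa : P b)
  have hm1 : m ≠ 1 := by
    intro h
    apply ha'
    have := (hdvd 1 0).2 (by rw [h]; simp)
    have h2 := hXk 0
    simp only [zpow_zero, sub_zero, Equiv.Perm.one_apply] at this h2
    rw [h2, this]
  have key : ∀ k : ℤ, (X ((r ^ k) a) = (r ^ k) a ∨ Y ((r ^ k) a) = (r ^ k) a) ↔
      ((m : ℤ) ∣ 1 - k - k ∨ (m : ℤ) ∣ -k - k) := by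
    intro k
    rw [hXk, hYk, hdvd, hdvd]
  obtain ⟨q, hq⟩ := Nat.even_or_odd' m
  refine ⟨(r ^ ((m + 1) / 2 : ℤ)) a, ⟨?_, hsr _, (key _).2 ?_⟩, ?_⟩
  · intro h
    have := (hdvd _ 0).1 (by simpa using h)
    obtain ⟨c, hc⟩ := this
    have h0 : 0 < (m + 1 : ℤ) / 2 := by omega
    have h1 : (m + 1 : ℤ) / 2 < m := by omega
    have h2 := Int.le_of_dvd (by omega) (Dvd.intro c hc.symm)
    omega
  · rcases hq with hq | hq
    · right; exact ⟨-1, by omega⟩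
    · left; exact ⟨-1, by omega⟩
  · rintro b ⟨hb, hab, hfix⟩
    obtain ⟨k, rfl⟩ := horb b hab
    rw [key] at hfix
    have hk : ¬ (m : ℤ) ∣ k := fun h => hb (by simpa using (hdvd k 0).2 (by simpa using h))
    rw [hdvd]
    rcases hq with hq | hq
    · rcases hfix with ⟨c, hc⟩ | ⟨c, hc⟩
      · exfalso
        have : (m : ℤ) * c = 2 * (q * c) := by rw [hq]; push_cast; ring
        omega
      · have h1 : (m : ℤ) * c = 2 * (q * c) := by rw [hq]; push_cast; ring
        have h2 : (m + 1 : ℤ) / 2 = q := by omega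
        rw [h2]
        obtain ⟨d, hd⟩ := Int.even_or_odd' c
        rcases hd with hd | hd
        · exfalso; apply hk
          refine ⟨-d, ?_⟩
          have : (q : ℤ) * c = m * d := by rw [hd, hq]; push_cast; ring
          rw [mul_neg]; omega
        · refine ⟨-d - 1, ?_⟩
          have : (q : ℤ) * c = m * d + q := by rw [hd, hq]; push_cast; ring
          rw [mul_sub, mul_neg, mul_one]; omega
    · have hm2 : (m : ℤ) = 2 * q + 1 := by omega
      have h2 : (m + 1 : ℤ) / 2 = q + 1 := by omega
      have cop : IsCoprime (m : ℤ) 2 := ⟨1, -q, by rw [hm2]; ring⟩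
      rcases hfix with h | h
      · refine cop.dvd_of_dvd_mul_left ?_
        rw [h2]
        have : 2 * (k - (q + 1)) = - (1 - k - k) - m := by omega
        rw [this]
        exact dvd_sub (dvd_neg.2 h) dvd_rfl
      · exfalso; apply hk
        refine cop.dvd_of_dvd_mul_left ?_
        have : 2 * k = - (-k - k) := by ring
        rw [this]
        exact dvd_neg.2 h

/-! ### Diagrams -/

/-- A Brauer diagram with top nodes `α` and bottom nodes `β`: an equivalence relation on the nodes
(`rel a b` means that `a = b` or `a` and `b` are the two ends of an arc) such that each node is
joined to precisely one other node. -/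
@[ext]
structure Diagram (α β : Type) where
  rel : Setoid (α ⊕ β)
  pair : ∀ a, ∃! b, b ≠ a ∧ rel a b

namespace Diagram

variable {α β γ ε : Type}

instance [Finite α] [Finite β] : Finite (Diagram α β) :=
  Finite.of_injective (fun d : Diagram α β => fun a b => d.rel a b) (by
    intro d d' h
    ext a b
    exact iff_of_eq (congrFun (congrFun h a) b))

/-- The node joined to `a`. -/
def partner (d : Diagram α β) (a : α ⊕ β) : α ⊕ β := (d.pair a).choose

theorem partner_ne (d : Diagram α β) (a : α ⊕ β) : d.partner a ≠ a := (d.pair a).choose_spec.1.1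

theorem rel_partner (d : Diagram α β) (a : α ⊕ β) : d.rel a (d.partner a) :=
  (d.pair a).choose_spec.1.2

theorem eq_partner (d : Diagram α β) {a b : α ⊕ β} (h : b ≠ a) (h' : d.rel a b) :
    b = d.partner a :=
  (d.pair a).choose_spec.2 b ⟨h, h'⟩

theorem rel_iff (d : Diagram α β) {a b : α ⊕ β} : d.rel a b ↔ b = a ∨ b = d.partner a := by
  constructor
  · intro h
    by_cases hb : b = a
    · exact .inl hb
    · exact .inr (d.eq_partner hb h)
  · rintro (rfl | rfl)
    · exact d.rel.refl _
    · exact d.rel_partner a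

theorem partner_partner (d : Diagram α β) (a : α ⊕ β) : d.partner (d.partner a) = a :=
  (d.eq_partner (d.partner_ne a).symm (d.rel.symm (d.rel_partner a))).symm

/-- Diagrams are the same thing as fixed-point-free involutions of the set of nodes. -/
def ofInvolution (f : α ⊕ β → α ⊕ β) (hf : ∀ a, f (f a) = a) (hf' : ∀ a, f a ≠ a) :
    Diagram α β where
  rel :=
    { r := fun a b => b = a ∨ b = f a
      iseqv :=
        { refl := fun a => .inl rfl
          symm := by
            rintro a b (rfl | rfl)
            · exact .inl rfl
            · exact .inr (hf a).symm
          trans := by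
            rintro a b c (rfl | rfl) (rfl | rfl)
            · exact .inl rfl
            · exact .inr rfl
            · exact .inr rfl
            · exact .inl (hf a) } }
  pair := fun a => ⟨f a, ⟨hf' a, .inr rfl⟩, fun b hb => hb.2.resolve_left hb.1⟩

theorem partner_ofInvolution (f : α ⊕ β → α ⊕ β) (hf : ∀ a, f (f a) = a) (hf' : ∀ a, f a ≠ a)
    (a : α ⊕ β) : (ofInvolution f hf hf').partner a = f a :=
  (eq_partner (ofInvolution f hf hf') (hf' a) (.inr rfl)).symm

theorem ext_partner {d d' : Diagram α β} (h : ∀ a, d.partner a = d'.partner a) : d = d' := by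
  ext a b
  rw [rel_iff, rel_iff, h]

/-- The equivalence relation of being connected in the concatenation of `x` (placed on top) and
`y`, the bottom nodes of `x` being identified with the top nodes of `y`. -/
def glue (x : Diagram α β) (y : Diagram β γ) : Setoid (α ⊕ β ⊕ γ) :=
  x.rel.map (Sum.map id Sum.inl) ⊔ y.rel.map Sum.inr

/-- The outer nodes of a concatenation. -/
abbrev outer : α ⊕ γ → α ⊕ β ⊕ γ := Sum.map id Sum.inr

theorem glue_le {x : Diagram α β} {y : Diagram β γ} {t : Setoid (α ⊕ β ⊕ γ)} :
    glue x y ≤ t ↔ (∀ a b, x.rel a b → t (Sum.map id Sum.inl a) (Sum.map id Sum.inl b)) ∧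
      ∀ a b, y.rel a b → t (Sum.inr a) (Sum.inr b) := by
  rw [glue, sup_le_iff, map_le, map_le]

theorem glue_pair [Finite α] [Finite β] [Finite γ] (x : Diagram α β) (y : Diagram β γ)
    (a : α ⊕ γ) : ∃! b, b ≠ a ∧ (glue x y).comap outer a b := by
  let X : Equiv.Perm (α ⊕ β ⊕ γ) := Function.Involutive.toPerm
    (Sum.elim (fun a => Sum.map id Sum.inl (x.partner (.inl a)))
      (Sum.elim (fun b => Sum.map id Sum.inl (x.partner (.inr b))) (fun c => .inr (.inr c)))) (by
    have key : ∀ u, Sum.elim (fun a => Sum.map id Sum.inl (x.partner (.inl a)))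
      (Sum.elim (fun b => Sum.map id Sum.inl (x.partner (.inr b)))
        (fun c : γ => .inr (.inr c))) (Sum.map id Sum.inl (x.partner u)) =
        (Sum.map id Sum.inl u : α ⊕ β ⊕ γ) := by
      intro u
      conv_rhs => rw [← x.partner_partner u]
      rcases x.partner u with v | v <;> rfl
    rintro (u | u | u)
    · exact key _
    · exact key _
    · rfl)
  let Y : Equiv.Perm (α ⊕ β ⊕ γ) := Function.Involutive.toPerm
    (Sum.elim Sum.inl (fun a => .inr (y.partner a))) (by
      rintro (u | u)
      · rfl
      · simp [y.partner_partner])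
  have hXx : ∀ u, X (Sum.map id Sum.inl u) = Sum.map id Sum.inl (x.partner u) := by
    rintro (u | u) <;> rfl
  have hXc : ∀ c, X (.inr (.inr c)) = .inr (.inr c) := fun c => rfl
  have hYy : ∀ u, Y (.inr u) = .inr (y.partner u) := fun u => rfl
  have hYa : ∀ a, Y (.inl a) = .inl a := fun u => rfl
  have hinj : Injective (Sum.map id Sum.inl : α ⊕ β → α ⊕ β ⊕ γ) :=
    Sum.map_injective.2 ⟨injective_id, Sum.inl_injective⟩
  have hX : ∀ v, X (X v) = v := fun v => Function.Involutive.toPerm_involutive _ v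
  have hY : ∀ v, Y (Y v) = v := fun v => Function.Involutive.toPerm_involutive _ v
  have hs : ∀ t : Setoid (α ⊕ β ⊕ γ), glue x y ≤ t ↔ (∀ v, t v (X v)) ∧ ∀ v, t v (Y v) := by
    intro t
    rw [glue_le]
    constructor
    · rintro ⟨h1, h2⟩
      constructor
      · rintro (u | u | u)
        · have := h1 _ _ (x.rel_partner (.inl u))
          rw [← hXx] at this; exact this
        · have := h1 _ _ (x.rel_partner (.inr u))
          rw [← hXx] at this; exact this
        · rw [hXc]
      · rintro (u | u)
        · rw [hYa]
        · rw [hYy]; exact h2 _ _ (y.rel_partner u)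
    · rintro ⟨h1, h2⟩
      constructor
      · intro a b hab
        rcases x.rel_iff.1 hab with rfl | rfl
        · exact t.refl _
        · rw [← hXx]; exact h1 _
      · intro a b hab
        rcases y.rel_iff.1 hab with rfl | rfl
        · exact t.refl _
        · rw [← hYy]; exact h2 _
  have hXne : ∀ u, X (Sum.map id Sum.inl u) ≠ Sum.map id Sum.inl u := fun u h =>
    x.partner_ne u (hinj (by rw [← hXx, h]))
  have hYne : ∀ u, Y (.inr u) ≠ .inr u := fun u h =>
    y.partner_ne u (Sum.inr_injective (by rw [← hYy, h]))
  have hfix : ∀ v, (X v = v ∨ Y v = v) ↔ ∃ b, v = outer b := by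
    rintro (u | u | u)
    · exact iff_of_true (.inr rfl) ⟨.inl u, rfl⟩
    · refine iff_of_false ?_ ?_
      · rintro (h | h)
        · exact hXne (.inr u) h
        · exact hYne _ h
      · rintro ⟨b | b, hb⟩ <;> simp [outer] at hb
    · exact iff_of_true (.inl rfl) ⟨.inr u, rfl⟩
  have hout : Injective (outer : α ⊕ γ → α ⊕ β ⊕ γ) :=
    Sum.map_injective.2 ⟨injective_id, Sum.inr_injective⟩
  have main : ∃! b, b ≠ outer a ∧ glue x y (outer a) b ∧ (X b = b ∨ Y b = b) := by
    rcases a with a | a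
    · exact dihedral X Y hX hY (.inl a) (hYa a) (hXne (.inl a)) _ hs
    · have := dihedral Y X hY hX (.inr (.inr a)) (hXc a) (hYne _) (glue x y)
        (fun t => by rw [hs, and_comm])
      simp only [or_comm] at this ⊢
      exact this
  obtain ⟨v, ⟨hv1, hv2, hv3⟩, hv4⟩ := main
  obtain ⟨b, rfl⟩ := (hfix v).1 hv3
  refine ⟨b, ⟨fun h => hv1 (by rw [h]), hv2⟩, ?_⟩
  rintro c ⟨hc1, hc2⟩
  exact hout (hv4 (outer c) ⟨fun h => hc1 (hout h), hc2, (hfix _).2 ⟨c, rfl⟩⟩)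

/-- The concatenation of `x` (placed on top) and `y`, closed loops being removed. -/
def comp [Finite α] [Finite β] [Finite γ] (x : Diagram α β) (y : Diagram β γ) : Diagram α γ where
  rel := (glue x y).comap outer
  pair := glue_pair x y

/-- The number of closed loops in the concatenation of `x` and `y`: the connected components which
contain no outer node. -/
def loops (x : Diagram α β) (y : Diagram β γ) : ℕ :=
  innerCount (glue x y) (outer : α ⊕ γ → α ⊕ β ⊕ γ)

/-- The diagram of a bijection: top node `e b` is joined to bottom node `b`. -/
def ofEquiv (e : β ≃ α) : Diagram α β :=
  ofInvolution (Sum.elim (fun a => .inr (e.symm a)) (fun b => .inl (e b)))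
    (by rintro (a | b) <;> simp) (by rintro (a | b) <;> simp)

theorem ofEquiv_rel (e : β ≃ α) (b : β) : (ofEquiv e).rel (.inl (e b)) (.inr b) :=
  .inr (by simp)

theorem setoid_map_map {A B C : Type} (s : Setoid A) (f : A → B) (g : B → C) :
    (s.map f).map g = s.map (g ∘ f) := by
  refine eq_of_forall_ge_iff fun t => ?_
  rw [map_le]
  exact (map_le (s := t.comap g)).trans (by rw [map_le]; rfl)

theorem setoid_map_sup {A B : Type} (s t : Setoid A) (f : A → B) :
    (s ⊔ t).map f = s.map f ⊔ t.map f := by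
  refine eq_of_forall_ge_iff fun u => ?_
  rw [sup_le_iff, map_le, map_le, map_le]
  exact (sup_le_iff (c := u.comap f))

section assoc

variable [Finite α] [Finite β] [Finite γ] [Finite ε]

/-- Being connected in the concatenation of three diagrams. -/
def glue₃ (x : Diagram α β) (y : Diagram β γ) (z : Diagram γ ε) : Setoid (α ⊕ β ⊕ γ ⊕ ε) :=
  x.rel.map (Sum.map id Sum.inl) ⊔ (y.rel.map (Sum.inr ∘ Sum.map id Sum.inl) ⊔
    z.rel.map (Sum.inr ∘ Sum.inr))

/-- The outer nodes of a triple concatenation. -/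
abbrev outer₃ : α ⊕ ε → α ⊕ β ⊕ γ ⊕ ε := Sum.map id (Sum.inr ∘ Sum.inr)

theorem assoc_left (x : Diagram α β) (y : Diagram β γ) (z : Diagram γ ε) :
    (comp (comp x y) z).rel = (glue₃ x y z).comap outer₃ ∧
    innerCount (glue₃ x y z) outer₃ = loops x y + loops (comp x y) z := by
  have := elim_aux (glue x y) (z.rel.map Sum.inr) (outer : α ⊕ γ → α ⊕ β ⊕ γ)
    (Sum.map id Sum.inl : α ⊕ γ → α ⊕ γ ⊕ ε) (Sum.map id (Sum.map id Sum.inl))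
    (Sum.map id Sum.inr : α ⊕ γ ⊕ ε → α ⊕ β ⊕ γ ⊕ ε) (by rintro (a | a) <;> rfl)
    (by
      rintro (a | a | a | a)
      · exact .inl ⟨.inl a, rfl⟩
      · exact .inl ⟨.inr (.inl a), rfl⟩
      · exact .inl ⟨.inr (.inr a), rfl⟩
      · exact .inr ⟨.inr (.inr a), rfl⟩)
    (by
      intro Q φ₀ φ₁ h
      refine ⟨Sum.elim (φ₀ ∘ .inl) (Sum.elim (φ₀ ∘ .inr ∘ .inl) (φ₁ ∘ .inr)), ?_, ?_⟩
      · rintro (a | a | a)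
        · rfl
        · rfl
        · exact (h (.inr a)).symm
      · rintro (a | a)
        · exact h (.inl a)
        · rfl)
    (outer : α ⊕ ε → α ⊕ γ ⊕ ε)
  have h3 : (glue x y).map (Sum.map id (Sum.map id Sum.inl)) ⊔
      (z.rel.map Sum.inr).map (Sum.map id Sum.inr : α ⊕ γ ⊕ ε → α ⊕ β ⊕ γ ⊕ ε) =
      glue₃ x y z := by
    rw [glue, setoid_map_sup, setoid_map_map, setoid_map_map, setoid_map_map, sup_assoc, glue₃]
    congr 2
    funext u; rcases u with u | u <;> rfl
  have h4 : (Sum.map id Sum.inr : α ⊕ γ ⊕ ε → α ⊕ β ⊕ γ ⊕ ε) ∘ outer = outer₃ := by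
    funext u; rcases u with u | u <;> rfl
  rw [h3, h4] at this
  refine ⟨?_, this.2⟩
  ext a b
  rw [Setoid.comap_rel, ← h4]
  exact (this.1 _ _).symm

theorem assoc_right (x : Diagram α β) (y : Diagram β γ) (z : Diagram γ ε) :
    (comp x (comp y z)).rel = (glue₃ x y z).comap outer₃ ∧
    innerCount (glue₃ x y z) outer₃ = loops y z + loops x (comp y z) := by
  have := elim_aux (glue y z) (x.rel.map (Sum.map id Sum.inl)) (outer : β ⊕ ε → β ⊕ γ ⊕ ε)
    (Sum.inr : β ⊕ ε → α ⊕ β ⊕ ε) Sum.inr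
    (Sum.map id outer : α ⊕ β ⊕ ε → α ⊕ β ⊕ γ ⊕ ε) (by rintro (a | a) <;> rfl)
    (by
      rintro (a | a)
      · exact .inr ⟨.inl a, rfl⟩
      · exact .inl ⟨a, rfl⟩)
    (by
      intro Q φ₀ φ₁ h
      refine ⟨Sum.elim (φ₁ ∘ .inl) φ₀, fun _ => rfl, ?_⟩
      rintro (a | a)
      · rfl
      · exact h a)
    (outer : α ⊕ ε → α ⊕ β ⊕ ε)
  have h3 : (glue y z).map Sum.inr ⊔
      (x.rel.map (Sum.map id Sum.inl)).map (Sum.map id outer : α ⊕ β ⊕ ε → α ⊕ β ⊕ γ ⊕ ε) =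
      glue₃ x y z := by
    rw [glue, setoid_map_sup, setoid_map_map, setoid_map_map, setoid_map_map, sup_comm, glue₃]
    congr 2
    funext u; rcases u with u | u <;> rfl
  have h4 : (Sum.map id outer : α ⊕ β ⊕ ε → α ⊕ β ⊕ γ ⊕ ε) ∘ outer = outer₃ := by
    funext u; rcases u with u | u <;> rfl
  have h5 : ((glue y z).comap outer).map Sum.inr ⊔ x.rel.map (Sum.map id Sum.inl) =
      glue x (comp y z) := sup_comm _ _
  rw [h3, h4, h5] at this
  refine ⟨?_, this.2⟩
  ext a b
  rw [Setoid.comap_rel, ← h4]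
  exact (this.1 _ _).symm

theorem comp_assoc (x : Diagram α β) (y : Diagram β γ) (z : Diagram γ ε) :
    comp (comp x y) z = comp x (comp y z) :=
  Diagram.ext ((assoc_left x y z).1.trans (assoc_right x y z).1.symm)

theorem loops_assoc (x : Diagram α β) (y : Diagram β γ) (z : Diagram γ ε) :
    loops x y + loops (comp x y) z = loops y z + loops x (comp y z) :=
  (assoc_left x y z).2.symm.trans (assoc_right x y z).2

end assoc

theorem glue_left {x : Diagram α β} {y : Diagram β γ} {a b : α ⊕ β} (h : x.rel a b) :
    glue x y (Sum.map id Sum.inl a) (Sum.map id Sum.inl b) :=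
  (glue_le.1 le_rfl).1 a b h

theorem glue_right {x : Diagram α β} {y : Diagram β γ} {a b : β ⊕ γ} (h : y.rel a b) :
    glue x y (.inr a) (.inr b) :=
  (glue_le.1 le_rfl).2 a b h

theorem innerCount_eq_zero {V A : Type} (s : Setoid V) (o : A → V) (h : ∀ v, ∃ a, s (o a) v) :
    innerCount s o = 0 := by
  have : IsEmpty {c : Quotient s // ∀ a, c ≠ Quotient.mk s (o a)} := by
    refine ⟨?_⟩
    rintro ⟨c, hc⟩
    induction c using Quotient.ind with | _ v
    obtain ⟨a, ha⟩ := h v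
    exact hc a (Quotient.sound (s.symm ha))
  exact Nat.card_of_isEmpty

theorem loops_ofEquiv (x : Diagram α β) (e : γ ≃ β) : loops x (ofEquiv e) = 0 := by
  refine innerCount_eq_zero _ _ ?_
  rintro (u | u | u)
  · exact ⟨.inl u, Setoid.refl' _ _⟩
  · refine ⟨.inr (e.symm u), Setoid.symm' _ ?_⟩
    have := glue_right (x := x) (ofEquiv_rel e (e.symm u))
    rwa [e.apply_symm_apply] at this
  · exact ⟨.inr u, Setoid.refl' _ _⟩

theorem ofEquiv_loops (e : β ≃ α) (x : Diagram β γ) : loops (ofEquiv e) x = 0 := by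
  refine innerCount_eq_zero _ _ ?_
  rintro (u | u | u)
  · exact ⟨.inl u, Setoid.refl' _ _⟩
  · exact ⟨.inl (e u), glue_left (ofEquiv_rel e u)⟩
  · exact ⟨.inr u, Setoid.refl' _ _⟩

theorem comp_ofEquiv_rel [Finite α] [Finite β] [Finite γ] (x : Diagram α β) (e : γ ≃ β) :
    (comp x (ofEquiv e)).rel = x.rel.comap (Sum.map id e) := by
  refine le_antisymm ?_ ?_
  · have : glue x (ofEquiv e) ≤ x.rel.comap (Sum.elim .inl (Sum.elim .inr (.inr ∘ e))) := by
      rw [glue_le]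
      constructor
      · rintro (a | a) (b | b) h <;> exact h
      · intro a b h
        rcases h with rfl | rfl
        · exact Setoid.refl' _ _
        · rcases a with a | a <;> simp [Setoid.comap_rel]
    intro a b h
    have := this h
    rcases a with a | a <;> rcases b with b | b <;> exact this
  · have key : ∀ u : α ⊕ γ, glue x (ofEquiv e) (outer u) (Sum.map id Sum.inl (Sum.map id e u)) := by
      rintro (u | u)
      · exact Setoid.refl' _ _
      · exact Setoid.symm' _ (glue_right (ofEquiv_rel e u))
    intro a b h
    exact Setoid.trans' (glue x (ofEquiv e)) (key a)
      (Setoid.trans' _ (glue_left h) (Setoid.symm' _ (key b)))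

theorem ofEquiv_comp_rel [Finite α] [Finite β] [Finite γ] (e : β ≃ α) (x : Diagram β γ) :
    (comp (ofEquiv e) x).rel = x.rel.comap (Sum.map e.symm id) := by
  refine le_antisymm ?_ ?_
  · have : glue (ofEquiv e) x ≤ x.rel.comap (Sum.elim (.inl ∘ e.symm) id) := by
      rw [glue_le]
      constructor
      · intro a b h
        rcases h with rfl | rfl
        · exact Setoid.refl' _ _
        · rcases a with a | a <;> simp [Setoid.comap_rel]
      · rintro a b h
        exact h
    intro a b h
    have := this h
    rcases a with a | a <;> rcases b with b | b <;> exact this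
  · have key : ∀ u : α ⊕ γ, glue (ofEquiv e) x (outer u) (Sum.inr (Sum.map e.symm id u)) := by
      rintro (u | u)
      · have := glue_left (y := x) (ofEquiv_rel e (e.symm u))
        rwa [e.apply_symm_apply] at this
      · exact Setoid.refl' _ _
    intro a b h
    exact Setoid.trans' (glue (ofEquiv e) x) (key a)
      (Setoid.trans' _ (glue_right h) (Setoid.symm' _ (key b)))

/-- The identity diagram. -/
def one (α : Type) : Diagram α α := ofEquiv (Equiv.refl α)

theorem comp_one [Finite α] [Finite β] (x : Diagram α β) : comp x (one β) = x := by
  apply Diagram.ext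
  rw [one, comp_ofEquiv_rel]
  simp

theorem one_comp [Finite α] [Finite β] (x : Diagram α β) : comp (one α) x = x := by
  apply Diagram.ext
  rw [one, ofEquiv_comp_rel]
  simp

theorem eq_of_rel_partner {d d' : Diagram α β} (h : ∀ a, d'.rel a (d.partner a)) : d = d' :=
  ext_partner fun a => d'.eq_partner (d.partner_ne a) (h a)

theorem ofEquiv_comp_ofEquiv [Finite α] [Finite β] [Finite γ] (e : β ≃ α) (e' : γ ≃ β) :
    comp (ofEquiv e) (ofEquiv e') = ofEquiv (e'.trans e) := by
  symm
  apply eq_of_rel_partner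
  intro a
  rw [comp_ofEquiv_rel, ofEquiv.eq_def (e'.trans e), partner_ofInvolution]
  refine .inr ?_
  rcases a with a | a <;> simp

end Diagram

/-! ### The Brauer algebra -/

/-- The Brauer algebra with parameter `δ`: linear combinations of Brauer diagrams with two rows of
`n` nodes. -/
def BrauerAlgebra (R : Type*) [CommRing R] (n : ℕ) (_δ : R) : Type _ :=
  Diagram (Fin n) (Fin n) →₀ R

namespace BrauerAlgebra

variable {R : Type*} [CommRing R] {n : ℕ} {δ : R}

instance : AddCommGroup (BrauerAlgebra R n δ) :=
  inferInstanceAs (AddCommGroup (Diagram (Fin n) (Fin n) →₀ R))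

instance : Module R (BrauerAlgebra R n δ) :=
  inferInstanceAs (Module R (Diagram (Fin n) (Fin n) →₀ R))

/-- The basis element given by a diagram. -/
def of (δ : R) (x : Diagram (Fin n) (Fin n)) : BrauerAlgebra R n δ := Finsupp.single x (1 : R)

/-- A linear map out of the Brauer algebra given by its values on diagrams. -/
def lin (δ : R) {M : Type*} [AddCommGroup M] [Module R M] (f : Diagram (Fin n) (Fin n) → M) :
    BrauerAlgebra R n δ →ₗ[R] M :=
  Finsupp.linearCombination R f

@[simp]
theorem lin_of {M : Type*} [AddCommGroup M] [Module R M] (f : Diagram (Fin n) (Fin n) → M)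
    (x : Diagram (Fin n) (Fin n)) : lin δ f (of δ x) = f x :=
  (Finsupp.linearCombination_single R 1 x).trans (one_smul R _)

theorem lin_ext {M : Type*} [AddCommGroup M] [Module R M] {f g : BrauerAlgebra R n δ →ₗ[R] M}
    (h : ∀ x, f (of δ x) = g (of δ x)) : f = g :=
  Finsupp.lhom_ext' fun x => LinearMap.ext_ring (h x)

/-- The multiplication of the Brauer algebra: `x * y = δ ^ t (xy)` for diagrams `x` and `y`, where
`xy` is the concatenation with its `t` closed loops removed. -/
def mulLin (δ : R) :
    BrauerAlgebra R n δ →ₗ[R] BrauerAlgebra R n δ →ₗ[R] BrauerAlgebra R n δ :=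
  lin δ fun x => lin δ fun y => δ ^ x.loops y • of δ (x.comp y)

instance : Mul (BrauerAlgebra R n δ) := ⟨fun a b => mulLin δ a b⟩

instance : One (BrauerAlgebra R n δ) := ⟨of δ (Diagram.one (Fin n))⟩

theorem one_def : (1 : BrauerAlgebra R n δ) = of δ (Diagram.one (Fin n)) := rfl

theorem mul_def (a b : BrauerAlgebra R n δ) : a * b = mulLin δ a b := rfl

theorem of_mul_of (x y : Diagram (Fin n) (Fin n)) :
    of δ x * of δ y = δ ^ x.loops y • of δ (x.comp y) := by
  simp [mul_def, mulLin]

theorem mul_assoc_aux (a b c : BrauerAlgebra R n δ) : a * b * c = a * (b * c) := by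
  have key : ∀ x y z : Diagram (Fin n) (Fin n),
      of δ x * of δ y * of δ z = of δ x * (of δ y * of δ z) := by
    intro x y z
    have e1 : ∀ (r : R) (u v : BrauerAlgebra R n δ), (r • u) * v = r • (u * v) := by
      intro r u v; simp [mul_def]
    have e2 : ∀ (r : R) (u v : BrauerAlgebra R n δ), u * (r • v) = r • (u * v) := by
      intro r u v; simp [mul_def]
    rw [of_mul_of, of_mul_of, e1, e2, of_mul_of, of_mul_of, smul_smul, smul_smul, ← pow_add,
      ← pow_add, Diagram.loops_assoc, Diagram.comp_assoc]
  have h1 : ∀ x y, mulLin δ (of δ x * of δ y) = (mulLin δ (of δ x)).comp (mulLin δ (of δ y)) :=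
    fun x y => lin_ext fun z => key x y z
  have h2 : ∀ x, (mulLin δ).comp (mulLin δ (of δ x)) =
      (LinearMap.llcomp R _ _ _ (mulLin δ (of δ x))).comp (mulLin δ) :=
    fun x => lin_ext fun y => h1 x y
  have h3 : LinearMap.compr₂ (mulLin δ) (mulLin δ) =
      ((LinearMap.llcomp R _ _ _).comp (mulLin δ)).compl₂ (mulLin δ) :=
    lin_ext fun x => h2 x
  exact congrArg (fun f => f a b c) h3

instance : Ring (BrauerAlgebra R n δ) :=
  { (inferInstance : AddCommGroup (BrauerAlgebra R n δ)),
    (inferInstance : Mul (BrauerAlgebra R n δ)),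
    (inferInstance : One (BrauerAlgebra R n δ)) with
    left_distrib := fun a b c => map_add (mulLin δ a) b c
    right_distrib := fun a b c => LinearMap.map_add₂ (mulLin δ) a b c
    zero_mul := fun a => LinearMap.map_zero₂ (mulLin δ) a
    mul_zero := fun a => map_zero (mulLin δ a)
    mul_assoc := mul_assoc_aux
    one_mul := fun a => by
      have : mulLin δ (of δ (Diagram.one (Fin n))) = LinearMap.id :=
        lin_ext fun x => by
          have := of_mul_of (δ := δ) (Diagram.one (Fin n)) x
          rw [Diagram.one_comp, Diagram.one, Diagram.ofEquiv_loops, pow_zero, one_smul] at this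
          exact this
      exact congrArg (fun f => f a) this
    mul_one := fun a => by
      have : (mulLin δ).flip (of δ (Diagram.one (Fin n))) = LinearMap.id :=
        lin_ext fun x => by
          have := of_mul_of (δ := δ) x (Diagram.one (Fin n))
          rw [Diagram.comp_one, Diagram.one, Diagram.loops_ofEquiv, pow_zero, one_smul] at this
          exact this
      exact congrArg (fun f => f a) this }

instance : Algebra R (BrauerAlgebra R n δ) :=
  Algebra.ofModule (fun r a b => LinearMap.map_smul₂ (mulLin δ) r a b)
    (fun r a b => map_smul (mulLin δ a) r b)

end BrauerAlgebra

/-! ### Specht modules -/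

section Specht

variable (F : Type*) [CommRing F]

/-- The permutation module spanned by all assignments of a row to each of the numbers in `Fin m`
(a tabloid being determined by the row of each entry), on which a permutation `g` acts by
replacing each entry `i` by `g i`. -/
def tabloidRep (m : ℕ) : Representation F (Equiv.Perm (Fin m)) ((Fin m → ℕ) →₀ F) where
  toFun g := Finsupp.lmapDomain F F fun r => r ∘ ⇑g⁻¹
  map_one' := by ext; simp
  map_mul' g h := by
    refine Finsupp.lhom_ext fun r a => ?_
    simp [Finsupp.mapDomain_single, Function.comp_assoc]

variable (lam : YoungDiagram)

/-- The tabloid of the bijective tableau `t` (having the entry `i` in the cell `t i`). -/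
def tabloid (t : Fin lam.card ≃ lam.cells) : Fin lam.card → ℕ := fun i => (t i).1.1

/-- The column stabiliser of a tableau. -/
def colStab (t : Fin lam.card ≃ lam.cells) : Finset (Equiv.Perm (Fin lam.card)) :=
  Finset.univ.filter fun s => ∀ i, (t (s i)).1.2 = (t i).1.2

/-- The polytabloid of a tableau `t`: the alternating sum of the tabloids of the tableaux obtained
from `t` by the column stabiliser. -/
def polytabloid (t : Fin lam.card ≃ lam.cells) : (Fin lam.card → ℕ) →₀ F :=
  ∑ s ∈ colStab lam t, ((Equiv.Perm.sign s : ℤ) : F) •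
    tabloidRep F lam.card s (Finsupp.single (tabloid lam t) 1)

/-- The Specht module: the span of the polytabloids. -/
def Specht : Submodule F ((Fin lam.card → ℕ) →₀ F) :=
  Submodule.span F (Set.range (polytabloid F lam))

theorem tabloidRep_polytabloid (g : Equiv.Perm (Fin lam.card)) (t : Fin lam.card ≃ lam.cells) :
    tabloidRep F lam.card g (polytabloid F lam t) = polytabloid F lam (g.symm.trans t) := by
  rw [polytabloid, polytabloid, map_sum]
  refine Finset.sum_equiv (MulAut.conj g).toEquiv ?_ ?_
  · intro s
    unfold colStab
    rw [Finset.mem_filter, Finset.mem_filter]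
    refine and_congr (by simp) ⟨fun h i => ?_, fun h i => ?_⟩
    · have := h (g.symm i)
      simpa [Equiv.Perm.mul_apply] using this
    · have := h (g i)
      simpa [Equiv.Perm.mul_apply] using this
  · intro s _
    have h1 : (Finsupp.single (tabloid lam (g.symm.trans t)) (1 : F)) =
        tabloidRep F lam.card g (Finsupp.single (tabloid lam t) 1) := by
      simp only [tabloidRep, MonoidHom.coe_mk, OneHom.coe_mk, Finsupp.lmapDomain_apply,
        Finsupp.mapDomain_single]
      rfl
    simp only [MulEquiv.toEquiv_eq_coe, MulEquiv.coe_toEquiv, MulAut.conj_apply]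
    rw [h1, map_smul, ← Module.End.mul_apply, ← Module.End.mul_apply, ← map_mul, ← map_mul]
    have h2 : Equiv.Perm.sign (g * s * g⁻¹) = Equiv.Perm.sign s := by
      rw [map_mul, map_mul, map_inv, mul_right_comm, mul_inv_cancel, one_mul]
    rw [h2, inv_mul_cancel_right]

theorem tabloidRep_mem (g : Equiv.Perm (Fin lam.card)) :
    ∀ x ∈ Specht F lam, tabloidRep F lam.card g x ∈ Specht F lam := by
  intro x hx
  induction hx using Submodule.span_induction with
  | mem x h =>
    obtain ⟨t, rfl⟩ := h
    rw [tabloidRep_polytabloid]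
    exact Submodule.subset_span ⟨_, rfl⟩
  | zero => simp
  | add x y _ _ hx hy => rw [map_add]; exact add_mem hx hy
  | smul a x _ hx => rw [map_smul]; exact Submodule.smul_mem _ _ hx

/-- The Specht module as a type. -/
def SpechtModule : Type _ := Specht F lam

instance : AddCommGroup (SpechtModule F lam) := inferInstanceAs (AddCommGroup (Specht F lam))

instance : Module F (SpechtModule F lam) := inferInstanceAs (Module F (Specht F lam))

/-- The action of the symmetric group on the Specht module. -/
def spechtRep : Representation F (Equiv.Perm (Fin lam.card)) (SpechtModule F lam) where
  toFun g := (tabloidRep F lam.card g).restrict (tabloidRep_mem F lam g)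
  map_one' := by
    refine LinearMap.ext fun x => Subtype.ext ?_
    change tabloidRep F lam.card 1 x.1 = x.1
    rw [map_one, Module.End.one_apply]
  map_mul' g h := by
    refine LinearMap.ext fun x => Subtype.ext ?_
    change tabloidRep F lam.card (g * h) x.1 = tabloidRep F lam.card g (tabloidRep F lam.card h x.1)
    rw [map_mul, Module.End.mul_apply]

end Specht

/-! ### Partial diagrams and cell modules -/

/-- A row of `n` nodes with some disjoint edges, such that exactly `m` nodes are free (so there are
`(n - m) / 2` edges). `arc i` is the node joined to `i`, and is `i` itself if `i` is free. -/
@[ext]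
structure PartialDiagram (n m : ℕ) where
  arc : Fin n → Fin n
  invol : ∀ i, arc (arc i) = i
  card_free : (Finset.univ.filter fun i => arc i = i).card = m

namespace PartialDiagram

variable {n m : ℕ}

/-- The free nodes, numbered from left to right. -/
def free (v : PartialDiagram n m) : Fin m ≃ {i // v.arc i = i} :=
  (Finset.orderIsoOfFin _ v.card_free).toEquiv.trans (Equiv.subtypeEquivRight (by simp))

/-- The diagram with top row `v`, whose bottom row has `m` nodes, the `j`-th of which is joined
to the `j`-th free node of `v`. -/
def toDiagram (v : PartialDiagram n m) : Diagram (Fin n) (Fin m) :=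
  Diagram.ofInvolution
    (Sum.elim (fun i => if h : v.arc i = i then .inr (v.free.symm ⟨i, h⟩) else .inl (v.arc i))
      (fun j => .inl (v.free j)))
    (by
      rintro (i | j)
      · by_cases h : v.arc i = i
        · simp [h]
        · have h' : ¬ v.arc (v.arc i) = v.arc i := by rw [v.invol]; exact fun e => h e.symm
          simp only [Sum.elim_inl, dif_neg h]
          rw [dif_neg h', v.invol]
      · have := (v.free j).2
        simp [this])
    (by
      rintro (i | j)
      · by_cases h : v.arc i = i
        · simp [h]
        · simp [h]
      · simp)

end PartialDiagram

namespace Diagram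

variable {n m : ℕ}

/-- No two bottom nodes are joined to each other; equivalently the top row has exactly
`(n - m) / 2` edges. -/
def Full (d : Diagram (Fin n) (Fin m)) : Prop :=
  ∀ i j : Fin m, i ≠ j → ¬ d.rel (.inr i) (.inr j)

/-- The node joined to `i` within the top row, or `i` itself if there is none. -/
def topArc (d : Diagram (Fin n) (Fin m)) (i : Fin n) : Fin n :=
  Sum.elim id (fun _ => i) (d.partner (.inl i))

theorem Full.exists {d : Diagram (Fin n) (Fin m)} (h : d.Full) (j : Fin m) :
    ∃ i, d.partner (.inr j) = .inl i := by
  rcases hp : d.partner (.inr j) with i | i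
  · exact ⟨i, rfl⟩
  · exfalso
    refine h j i ?_ ?_
    · rintro rfl
      exact d.partner_ne _ hp
    · rw [← hp]; exact d.rel_partner _

theorem exists_bot {d : Diagram (Fin n) (Fin m)} {i : Fin n} (hi : d.topArc i = i) :
    ∃ j, d.partner (.inl i) = .inr j := by
  rcases hp : d.partner (.inl i) with j | j
  · exfalso
    rw [topArc, hp] at hi
    exact d.partner_ne _ (hp.trans (congrArg _ hi))
  · exact ⟨j, rfl⟩

/-- The top node joined to each bottom node. -/
def topEquiv (d : Diagram (Fin n) (Fin m)) (h : d.Full) : Fin m ≃ {i // d.topArc i = i} where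
  toFun j := ⟨(h.exists j).choose, by
    have := (h.exists j).choose_spec
    rw [topArc, ← this, d.partner_partner]
    rfl⟩
  invFun i := (exists_bot i.2).choose
  left_inv j := by
    have h1 := (h.exists j).choose_spec
    have h2 : d.topArc (h.exists j).choose = (h.exists j).choose := by
      rw [topArc, ← h1, d.partner_partner]
      rfl
    have h3 := (exists_bot h2).choose_spec
    have h4 := (congrArg d.partner h1).symm.trans (d.partner_partner _)
    exact Sum.inr_injective (h3.symm.trans h4)
  right_inv i := by
    have h1 := (exists_bot i.2).choose_spec
    apply Subtype.ext
    have h3 := (h.exists (exists_bot i.2).choose).choose_spec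
    have h4 := (congrArg d.partner h1).symm.trans (d.partner_partner _)
    exact Sum.inl_injective (h3.symm.trans h4)

theorem partner_inr (d : Diagram (Fin n) (Fin m)) (h : d.Full) (j : Fin m) :
    d.partner (.inr j) = .inl (d.topEquiv h j : Fin n) := (h.exists j).choose_spec

/-- The top row of a diagram, the nodes joined to the bottom row being made free. -/
def topRow (d : Diagram (Fin n) (Fin m)) (h : d.Full) : PartialDiagram n m where
  arc := d.topArc
  invol i := by
    rcases hp : d.partner (.inl i) with j | j
    · have hj : d.topArc i = j := by rw [topArc, hp]; rfl
      rw [hj, topArc, ← hp, d.partner_partner]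
      rfl
    · have hj : d.topArc i = i := by rw [topArc, hp]; rfl
      rw [hj, hj]
  card_free := by
    rw [← Fintype.card_subtype, ← Fintype.card_congr (d.topEquiv h), Fintype.card_fin]

/-- The permutation on the free nodes: the bottom node `j` is joined to the free node of number
`d.freePerm h j` of the top row. -/
def freePerm (d : Diagram (Fin n) (Fin m)) (h : d.Full) : Equiv.Perm (Fin m) :=
  (d.topEquiv h).trans (d.topRow h).free.symm

theorem eq_toDiagram_comp (d : Diagram (Fin n) (Fin m)) (h : d.Full) :
    d = (d.topRow h).toDiagram.comp (ofEquiv (d.freePerm h)) := by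
  apply eq_of_rel_partner
  rw [comp_ofEquiv_rel]
  have hr : ∀ j, (d.topRow h).toDiagram.rel (.inr (d.freePerm h j))
      (.inl (d.topEquiv h j : Fin n)) := by
    intro j
    refine .inr ?_
    simp only [Sum.elim_inr, freePerm]
    congr 1
    exact congrArg Subtype.val
      ((d.topRow h).free.apply_symm_apply (d.topEquiv h j)).symm
  rintro (i | j)
  · rcases hp : d.partner (.inl i) with k | k
    · refine .inr ?_
      have hk : d.topArc i = k := by rw [topArc, hp]; rfl
      have hne : ¬ (d.topRow h).arc i = i := by
        intro e
        have : k = i := hk.symm.trans e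
        exact d.partner_ne _ (hp.trans (congrArg _ this))
      simp only [Sum.map_inl, id, Sum.elim_inl, dif_neg hne]
      exact congrArg _ hk.symm
    · have h1 := d.partner_inr h k
      rw [← hp, d.partner_partner] at h1
      have h2 := hr k
      rw [← h1] at h2
      exact Setoid.symm' _ h2
  · rw [d.partner_inr h]
    exact hr j

theorem toDiagram_comp_partner_inr (v : PartialDiagram n m) (s : Equiv.Perm (Fin m)) (j : Fin m) :
    (v.toDiagram.comp (ofEquiv s)).partner (.inr j) = .inl (v.free (s j) : Fin n) := by
  symm
  apply eq_partner
  · simp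
  · rw [comp_ofEquiv_rel]
    exact .inr rfl

theorem toDiagram_comp_full (v : PartialDiagram n m) (s : Equiv.Perm (Fin m)) :
    (v.toDiagram.comp (ofEquiv s)).Full := by
  intro i j hij h
  have := eq_partner _ (fun e => hij (Sum.inr_injective e).symm) h
  rw [toDiagram_comp_partner_inr] at this
  simp at this

theorem topRow_toDiagram_comp (v : PartialDiagram n m) (s : Equiv.Perm (Fin m))
    (h : (v.toDiagram.comp (ofEquiv s)).Full) :
    (v.toDiagram.comp (ofEquiv s)).topRow h = v := by
  ext1
  funext i
  change topArc _ i = _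
  by_cases hi : v.arc i = i
  · have : (v.toDiagram.comp (ofEquiv s)).partner (.inl i) =
        .inr (s.symm (v.free.symm ⟨i, hi⟩)) := by
      symm
      apply eq_partner
      · simp
      · rw [comp_ofEquiv_rel]
        refine .inr ?_
        simp [hi]
    rw [topArc, this, hi]
    rfl
  · have : (v.toDiagram.comp (ofEquiv s)).partner (.inl i) = .inl (v.arc i) := by
      symm
      apply eq_partner
      · simpa using hi
      · rw [comp_ofEquiv_rel]
        refine .inr ?_
        simp [hi]
    rw [topArc, this]
    rfl

theorem freePerm_toDiagram_comp (v : PartialDiagram n m) (s : Equiv.Perm (Fin m))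
    (h : (v.toDiagram.comp (ofEquiv s)).Full) :
    (v.toDiagram.comp (ofEquiv s)).freePerm h = s := by
  have key : ∀ (w : PartialDiagram n m) (k l : Fin m), w = v →
      (w.free k : Fin n) = v.free l → k = l := by
    rintro w k l rfl e
    exact w.free.injective (Subtype.ext e)
  ext1 j
  refine key _ _ _ (topRow_toDiagram_comp v s h) ?_
  have h1 := partner_inr _ h j
  rw [toDiagram_comp_partner_inr] at h1
  have h2 : ((topRow _ h).free (freePerm _ h j) : Fin n) = topEquiv _ h j :=
    congrArg Subtype.val ((topRow _ h).free.apply_symm_apply (topEquiv _ h j))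
  rw [h2]
  exact (Sum.inl_injective h1).symm

theorem Full.of_comp {x : Diagram (Fin n) (Fin n)} {d : Diagram (Fin n) (Fin m)}
    (h : (x.comp d).Full) : d.Full := by
  intro i j hij hd
  exact h i j hij (glue_right (x := x) hd)

theorem Full.comp_ofEquiv {d : Diagram (Fin n) (Fin m)} (h : d.Full) (s : Equiv.Perm (Fin m)) :
    (d.comp (ofEquiv s)).Full := by
  intro i j hij hd
  rw [comp_ofEquiv_rel] at hd
  exact h _ _ (fun e => hij (s.injective e)) hd

theorem Full.of_comp_ofEquiv {d : Diagram (Fin n) (Fin m)} {s : Equiv.Perm (Fin m)}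
    (h : (d.comp (ofEquiv s)).Full) : d.Full := by
  intro i j hij hd
  refine h (s.symm i) (s.symm j) (fun e => hij (s.symm.injective e)) ?_
  rw [comp_ofEquiv_rel]
  simpa [Setoid.comap_rel] using hd

theorem topRow_freePerm_of_eq {d : Diagram (Fin n) (Fin m)} (h : d.Full) (v : PartialDiagram n m)
    (s : Equiv.Perm (Fin m)) (e : d = v.toDiagram.comp (ofEquiv s)) :
    d.topRow h = v ∧ d.freePerm h = s := by
  subst e
  exact ⟨topRow_toDiagram_comp v s h, freePerm_toDiagram_comp v s h⟩

theorem comp_ofEquiv_decomp {d : Diagram (Fin n) (Fin m)} (h : d.Full) (s : Equiv.Perm (Fin m))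
    (h' : (d.comp (ofEquiv s)).Full) :
    (d.comp (ofEquiv s)).topRow h' = d.topRow h ∧
      (d.comp (ofEquiv s)).freePerm h' = d.freePerm h * s := by
  apply topRow_freePerm_of_eq
  conv_lhs => rw [eq_toDiagram_comp d h]
  rw [comp_assoc, ofEquiv_comp_ofEquiv]
  rfl

end Diagram

/-- The cell module `Δ_n(λ)` with parameter `δ`, as a module over the ground ring: the tensor
product of the free module on the partial diagrams having `|λ|` free nodes and of the Specht
module of `λ`. The element `Finsupp.single v s` is the pure tensor `v ⊗ s`. -/
def CellModule (F : Type*) [CommRing F] (n : ℕ) (_δ : F) (lam : YoungDiagram) : Type _ :=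
  PartialDiagram n lam.card →₀ SpechtModule F lam

namespace CellModule

variable {F : Type*} [CommRing F] {n : ℕ} {δ : F} {lam : YoungDiagram}

instance : AddCommGroup (CellModule F n δ lam) :=
  inferInstanceAs (AddCommGroup (PartialDiagram n lam.card →₀ SpechtModule F lam))

instance : Module F (CellModule F n δ lam) :=
  inferInstanceAs (Module F (PartialDiagram n lam.card →₀ SpechtModule F lam))

/-- The linear map `s ↦ v ⊗ s`. -/
def tmul (δ : F) (v : PartialDiagram n lam.card) : SpechtModule F lam →ₗ[F] CellModule F n δ lam :=
  Finsupp.lsingle v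

/-- A linear map given by its values on the elements `v ⊗ s`. -/
def lin (δ : F) {M : Type*} [AddCommGroup M] [Module F M]
    (f : PartialDiagram n lam.card → SpechtModule F lam →ₗ[F] M) : CellModule F n δ lam →ₗ[F] M :=
  Finsupp.lsum F f

@[simp]
theorem lin_tmul {M : Type*} [AddCommGroup M] [Module F M]
    (f : PartialDiagram n lam.card → SpechtModule F lam →ₗ[F] M) (v : PartialDiagram n lam.card)
    (s : SpechtModule F lam) : lin δ f (tmul δ v s) = f v s :=
  Finsupp.lsum_single F f v s

theorem lin_ext {M : Type*} [AddCommGroup M] [Module F M] {f g : CellModule F n δ lam →ₗ[F] M}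
    (h : ∀ v s, f (tmul δ v s) = g (tmul δ v s)) : f = g :=
  Finsupp.lhom_ext h

open Classical in
/-- The value `x (v ⊗ s) = δ ^ j (x v) ⊗ σ(x, v) s` of a diagram `x`, where `x v` is obtained from
the concatenation of `x` (on top) and `v`, `j` is the number of closed loops and `σ(x, v)` is the
permutation on the free nodes; it is zero if `x v` has more edges than `v`. -/
def actOn (δ : F) (x : Diagram (Fin n) (Fin n)) (v : PartialDiagram n lam.card) :
    SpechtModule F lam →ₗ[F] CellModule F n δ lam :=
  if h : (x.comp v.toDiagram).Full then
    δ ^ x.loops v.toDiagram • (tmul δ ((x.comp v.toDiagram).topRow h)).comp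
      (spechtRep F lam ((x.comp v.toDiagram).freePerm h))
  else 0

/-- The action of a diagram on the cell module. -/
def act (δ : F) (x : Diagram (Fin n) (Fin n)) : Module.End F (CellModule F n δ lam) :=
  lin δ (actOn δ x)

theorem act_tmul_of_full {x : Diagram (Fin n) (Fin n)} {v : PartialDiagram n lam.card}
    (h : (x.comp v.toDiagram).Full) (s : SpechtModule F lam) :
    act δ x (tmul δ v s) = δ ^ x.loops v.toDiagram • tmul δ ((x.comp v.toDiagram).topRow h)
      (spechtRep F lam ((x.comp v.toDiagram).freePerm h) s) := by
  rw [act, lin_tmul, actOn, dif_pos h]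
  rfl

theorem act_tmul_of_not_full {x : Diagram (Fin n) (Fin n)} {v : PartialDiagram n lam.card}
    (h : ¬ (x.comp v.toDiagram).Full) (s : SpechtModule F lam) :
    act δ x (tmul δ v s) = 0 := by
  rw [act, lin_tmul, actOn, dif_neg h]
  rfl

theorem act_one : act δ (Diagram.one (Fin n)) = (1 : Module.End F (CellModule F n δ lam)) := by
  apply lin_ext
  intro v s
  have e : (Diagram.one (Fin n)).comp v.toDiagram =
      v.toDiagram.comp (Diagram.ofEquiv (1 : Equiv.Perm (Fin lam.card))) := by
    rw [Diagram.one_comp]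
    exact (Diagram.comp_one _).symm
  have h : ((Diagram.one (Fin n)).comp v.toDiagram).Full := by
    rw [e]; exact Diagram.toDiagram_comp_full _ _
  obtain ⟨h1, h2⟩ := Diagram.topRow_freePerm_of_eq h v 1 e
  rw [act_tmul_of_full h, h1, h2, Diagram.one, Diagram.ofEquiv_loops]
  simp

theorem act_mul (x y : Diagram (Fin n) (Fin n)) :
    δ ^ x.loops y • act δ (x.comp y) = (act δ x * act δ y : Module.End F (CellModule F n δ lam)) := by
  apply lin_ext
  intro v s
  rw [LinearMap.smul_apply, Module.End.mul_apply]
  by_cases hy : (y.comp v.toDiagram).Full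
  · rw [act_tmul_of_full hy, map_smul]
    set w := (y.comp v.toDiagram).topRow hy with hw
    set g := (y.comp v.toDiagram).freePerm hy with hg
    have hd : y.comp v.toDiagram = w.toDiagram.comp (Diagram.ofEquiv g) :=
      Diagram.eq_toDiagram_comp _ hy
    have hxy : (x.comp y).comp v.toDiagram =
        (x.comp w.toDiagram).comp (Diagram.ofEquiv g) := by
      rw [Diagram.comp_assoc, hd, Diagram.comp_assoc]
    have hl : x.loops y + (x.comp y).loops v.toDiagram =
        y.loops v.toDiagram + x.loops w.toDiagram := by
      rw [Diagram.loops_assoc, hd]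
      congr 1
      have := Diagram.loops_assoc x w.toDiagram (Diagram.ofEquiv g)
      rw [Diagram.loops_ofEquiv, Diagram.loops_ofEquiv, add_zero, zero_add] at this
      exact this.symm
    by_cases hx : (x.comp w.toDiagram).Full
    · have hf : ((x.comp y).comp v.toDiagram).Full := by
        rw [hxy]; exact hx.comp_ofEquiv g
      have key : ((x.comp y).comp v.toDiagram).topRow hf = (x.comp w.toDiagram).topRow hx ∧
          ((x.comp y).comp v.toDiagram).freePerm hf = (x.comp w.toDiagram).freePerm hx * g := by
        have := Diagram.comp_ofEquiv_decomp hx g (hx.comp_ofEquiv g)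
        revert hf
        rw [hxy]
        intro hf
        exact this
      rw [act_tmul_of_full hx, act_tmul_of_full hf, key.1, key.2, smul_smul, smul_smul, ← pow_add,
        ← pow_add, hl, map_mul, Module.End.mul_apply]
    · have hf : ¬ ((x.comp y).comp v.toDiagram).Full := by
        rw [hxy]; exact fun h => hx h.of_comp_ofEquiv
      rw [act_tmul_of_not_full hx, act_tmul_of_not_full hf, smul_zero, smul_zero]
  · have hf : ¬ ((x.comp y).comp v.toDiagram).Full := by
      rw [Diagram.comp_assoc]; exact fun h => hy h.of_comp
    rw [act_tmul_of_not_full hf, act_tmul_of_not_full hy, smul_zero, map_zero]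

/-- The representation of the Brauer algebra on the cell module. -/
def rep (F : Type*) [CommRing F] (n : ℕ) (δ : F) (lam : YoungDiagram) :
    BrauerAlgebra F n δ →+* Module.End F (CellModule F n δ lam) where
  toFun := BrauerAlgebra.lin δ (act δ)
  map_zero' := map_zero _
  map_add' := map_add _
  map_one' := by rw [BrauerAlgebra.one_def, BrauerAlgebra.lin_of, act_one]
  map_mul' a b := by
    have h1 : ∀ x y : Diagram (Fin n) (Fin n),
        BrauerAlgebra.lin δ (act δ (lam := lam)) (BrauerAlgebra.of δ x * BrauerAlgebra.of δ y) =
          act δ x * act δ y := by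
      intro x y
      rw [BrauerAlgebra.of_mul_of, map_smul, BrauerAlgebra.lin_of, act_mul]
    have h2 : (BrauerAlgebra.mulLin δ).compr₂ (BrauerAlgebra.lin δ (act δ (n := n) (lam := lam))) =
        (LinearMap.mul F (Module.End F (CellModule F n δ lam))).compl₁₂
          (BrauerAlgebra.lin δ (act δ)) (BrauerAlgebra.lin δ (act δ)) :=
      BrauerAlgebra.lin_ext fun x => BrauerAlgebra.lin_ext fun y => by
        have := h1 x y
        simpa [BrauerAlgebra.mul_def] using this
    exact congrArg (fun f => f a b) h2

/-- The cell module as a (left) module over the Brauer algebra. -/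
instance : Module (BrauerAlgebra F n δ) (CellModule F n δ lam) :=
  Module.compHom _ (rep F n δ lam)

theorem smul_def (a : BrauerAlgebra F n δ) (x : CellModule F n δ lam) :
    a • x = rep F n δ lam a x := rfl

end CellModule

/-! ### Blocks -/

/-- `b` is a primitive central idempotent of the ring `A`. The blocks of `A`, i.e. the indecomposable
two-sided direct summands of `A`, are the ideals `A b` for such `b`. -/
structure IsBlockIdempotent {A : Type*} [Ring A] (b : A) : Prop where
  idem : b * b = b
  central : ∀ a, a * b = b * a
  ne_zero : b ≠ 0
  primitive : ∀ e, e * e = e → (∀ a, a * e = e * a) → e * b = e → e = 0 ∨ e = b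

/-- The module `M` lies in the block `A b`, i.e. `(A b) M = M` and all other blocks annihilate
`M`. -/
def LiesInBlock {A : Type*} [Ring A] (b : A) (M : Type*) [AddCommGroup M] [Module A M] : Prop :=
  ∀ x : M, b • x = x

/-- The partitions of `n, n - 2, n - 4, …`, the labels of the cell modules. -/
def Label (n : ℕ) : Type := {lam : YoungDiagram // ∃ t, lam.card + 2 * t = n}

/-- The set `𝓑_n(λ)` of the partitions which label cell modules in the block of the Brauer algebra
that contains `Δ_n(λ)`. -/
def blockSet (F : Type*) [Field F] (n : ℕ) (δ : F) (lam : Label n) : Set (Label n) :=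
  {mu | ∃ b : BrauerAlgebra F n δ, IsBlockIdempotent b ∧
    LiesInBlock b (CellModule F n δ lam.1) ∧ LiesInBlock b (CellModule F n δ mu.1)}

end Brauer

end

noncomputable section

namespace Brauer

/-! ### Lifting central idempotents -/

section Lift

variable {A : Type*} [Ring A]

/-! Blocks are compared through central characters. Write `A` for the Brauer algebra over `R`. A
central element of a Brauer algebra over any commutative ring acts on each cell module by a scalar
(`CellModule.exists_central_smul`), and these scalars are compatible with extension of scalars to
`K` and with reduction to `k` (`CellModule.baseChange_smul_basicElt`).

Let `e` be the idempotent of the block over `k` that contains the cell module of `λ`. It lifts to a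
central element `z` of `A` (`exists_central_lift`), which acts on the cell modules of `λ` and `μ` by
scalars `c` and `d` of `R`. Over `K` the two modules share a block, and the centre of a block is
local (`IsBlockIdempotent.exists_pow_mul_eq_zero`). Since `z - c` kills a nonzero vector, it is
nilpotent on the block, so a power of `d - c` vanishes and `c = d`. Modulo the maximal ideal `c`
becomes `1`, because `e` is the identity on the module of `λ`. Hence `e` is the identity on the
module of `μ` as well.

The lift `z` need not be idempotent: `R` is not assumed complete. It comes from Newton iteration to
a finite precision, followed by a correction supplied by the Artin–Rees lemma.

That central elements act by scalars is proved without Schur's lemma, so that it holds over `R` and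
in every characteristic. Comparing coefficients in `z (v w*) = (v w*) z`, for half diagrams `v` and
`w`, shows that `z` acts on `v ⊗ s` through a class function on the symmetric group, independent of
`v`. A class function commutes with the signed column sum of a tableau, which sends every tabloid of
that shape to a multiple of the polytabloid, so each polytabloid is an eigenvector. -/

theorem dvd_mul_left_of_central {c : A} (hc : ∀ a, c * a = a * c) {x : A} (h : c ∣ x) (a : A) :
    c ∣ a * x := by
  obtain ⟨y, rfl⟩ := h
  exact ⟨a * y, by rw [← mul_assoc, ← hc, mul_assoc]⟩

theorem pow_central {c : A} (hc : ∀ a, c * a = a * c) (j : ℕ) (a : A) :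
    c ^ j * a = a * c ^ j :=
  ((show Commute c a from hc a).pow_left j).eq

theorem pow_dvd_mul {c : A} (hc : ∀ a, c * a = a * c) {i j : ℕ} {x y : A} (hx : c ^ i ∣ x)
    (hy : c ^ j ∣ y) : c ^ (i + j) ∣ x * y := by
  obtain ⟨u, rfl⟩ := hx
  obtain ⟨v, rfl⟩ := hy
  refine ⟨u * v, ?_⟩
  rw [pow_add, mul_assoc, ← mul_assoc u, ← pow_central hc, mul_assoc, mul_assoc]

/-- An idempotent modulo a central element `c` lifts to an idempotent modulo `c ^ (N + 1)`. -/
theorem exists_idem_lift {B : Type*} [Ring B] (φ : A →+* B) (hφ : Function.Surjective φ) {c : A}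
    (hc : ∀ a, c * a = a * c) (hker : ∀ a, φ a = 0 → c ∣ a) {e : B} (he : e * e = e) (N : ℕ) :
    ∃ a, φ a = e ∧ c ^ (N + 1) ∣ a * a - a := by
  induction N with
  | zero =>
    obtain ⟨a, rfl⟩ := hφ e
    exact ⟨a, rfl, by rw [zero_add, pow_one]; exact hker _ (by rw [map_sub, map_mul, he, sub_self])⟩
  | succ N ih =>
    obtain ⟨a, rfl, ha⟩ := ih
    -- Newton step for `X² - X`: the polynomial `3X² - 2X³` fixes idempotents, and its defect is
    -- divisible by the square of the old one. So the exponent `N + 1` at least becomes `2(N + 1) ≥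
    -- N + 2`.
    refine ⟨3 * (a * a) - 2 * (a * a * a), ?_, ?_⟩
    · rw [map_sub, map_mul, map_mul, map_mul, map_mul, map_mul, he, he, map_ofNat, map_ofNat]
      noncomm_ring
    · have h1 : (3 * (a * a) - 2 * (a * a * a)) * (3 * (a * a) - 2 * (a * a * a)) -
          (3 * (a * a) - 2 * (a * a * a)) =
          (a * a - a) * (a * a - a) * (4 * (a * a - a) - 3) := by noncomm_ring
      rw [h1]
      exact Dvd.dvd.mul_right ((pow_dvd_pow c (by omega)).trans (pow_dvd_mul hc ha ha)) _

/-- An idempotent modulo `c ^ N` that is central modulo `c` is central modulo `c ^ N`. -/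
theorem dvd_commutator {c : A} (hc : ∀ a, c * a = a * c) {e : A} {N : ℕ}
    (he : c ^ N ∣ e * e - e) (h : ∀ x, c ∣ x * e - e * x) (x : A) : c ^ N ∣ x * e - e * x := by
  have hl : ∀ j (a : A) {y : A}, c ^ j ∣ y → c ^ j ∣ a * y := fun j a y hy =>
    dvd_mul_left_of_central (pow_central hc j) hy a
  rcases N with _ | N
  · simp
  have he1 : c ∣ e * e - e := (dvd_pow_self c N.succ_ne_zero).trans he
  -- The commutator is the difference of the two off-diagonal Peirce components `(1 - e)xe` and
  -- `ex(1 - e)`. Both are divisible by `c`, and the divisibility is raised one power at a time.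
  have b1 : ∀ x, c ∣ e * x * (1 - e) := by
    intro x
    have : e * x * (1 - e) = -((e * e - e) * x) - e * (x * e - e * x) := by noncomm_ring
    rw [this]
    exact dvd_sub (dvd_neg.2 (he1.mul_right x)) (dvd_mul_left_of_central hc (h x) e)
  have b2 : ∀ x, c ∣ (1 - e) * x * e := by
    intro x
    have : (1 - e) * x * e = (x * e - e * x) * e - x * (e * e - e) := by noncomm_ring
    rw [this]
    exact dvd_sub ((h x).mul_right e) (dvd_mul_left_of_central hc he1 x)
  have step : ∀ j (a b y : A), (∀ y, c ∣ a * y * b) → c ^ j ∣ y → c ^ (j + 1) ∣ a * y * b := by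
    rintro j a b _ hab ⟨y, rfl⟩
    obtain ⟨u, hu⟩ := hab y
    refine ⟨u, ?_⟩
    rw [← mul_assoc, ← pow_central hc, mul_assoc, mul_assoc, ← mul_assoc a, hu, pow_succ, mul_assoc]
  have key : ∀ j, j ≤ N + 1 → ∀ x, c ^ j ∣ e * x * (1 - e) ∧ c ^ j ∣ (1 - e) * x * e := by
    intro j
    induction j with
    | zero => intro _ x; simp
    | succ j ih =>
      intro hj x
      obtain ⟨ih1, ih2⟩ := ih (by omega) x
      have hw : c ^ (j + 1) ∣ e * e - e := (pow_dvd_pow c hj).trans he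
      constructor
      -- Up to multiples of `e² - e`, projecting to a Peirce component twice changes nothing, and
      -- the second projection gains another factor `c` by `step`.
      · have : e * x * (1 - e) = e * (e * x * (1 - e)) * (1 - e) - (e * e - e) * (x * (1 - e)) -
            e * x * (e * e - e) - (e * e - e) * (x * (e * e - e)) := by noncomm_ring
        rw [this]
        exact dvd_sub (dvd_sub (dvd_sub (step _ _ _ _ b1 ih1) (hw.mul_right _)) (hl _ _ hw))
          (hw.mul_right _)
      · have : (1 - e) * x * e = (1 - e) * ((1 - e) * x * e) * e - (e * e - e) * (x * e) -
            (1 - e) * x * (e * e - e) - (e * e - e) * (x * (e * e - e)) := by noncomm_ring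
        rw [this]
        exact dvd_sub (dvd_sub (dvd_sub (step _ _ _ _ b2 ih2) (hw.mul_right _)) (hl _ _ hw))
          (hw.mul_right _)
  have h1 := (key (N + 1) le_rfl x).1
  have h2 := (key (N + 1) le_rfl x).2
  have : x * e - e * x = (1 - e) * x * e - e * x * (1 - e) := by noncomm_ring
  rw [this]
  exact dvd_sub h2 h1

/-- If `φ : A → B` is reduction of a finite algebra over a noetherian ring modulo `ϖ`, then every
central idempotent of `B` is the image of a central element of `A`. -/
theorem exists_central_lift {R B : Type*} [CommRing R] [IsNoetherianRing R] [Algebra R A]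
    [Module.Finite R A] [Ring B] (φ : A →+* B) (hφ : Function.Surjective φ) (ϖ : R)
    (hker : ∀ a, φ a = 0 ↔ ∃ y, a = ϖ • y) {e : B} (he : e * e = e)
    (hcen : ∀ b, b * e = e * b) : ∃ z : A, (∀ a, a * z = z * a) ∧ φ z = e := by
  set c : A := algebraMap R A ϖ
  have hc : ∀ a, c * a = a * c := fun a => Algebra.commutes ϖ a
  have hker' : ∀ a, φ a = 0 → c ∣ a := by
    intro a ha
    obtain ⟨y, rfl⟩ := (hker a).1 ha
    exact ⟨y, Algebra.smul_def _ _⟩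
  obtain ⟨s, hs⟩ := Module.Finite.fg_top (R := R) (M := A)
  -- Commutators with a finite set of module generators: the kernel of `D` is the centre.
  let D : A →ₗ[R] (s → A) := LinearMap.pi fun i =>
    LinearMap.mulLeft R (i : A) - LinearMap.mulRight R (i : A)
  have hD : ∀ a i, D a i = (i : A) * a - a * i := fun a i => rfl
  -- Artin–Rees for the image of `D`. The constant `k` fixes the precision: a lift that is
  -- idempotent, hence central, modulo `ϖ ^ (k + 1)` has `D a` in `ϖ • range D`, so `D a = ϖ • D
  -- a'`, and `a - ϖ • a'` is a central lift of `e`.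
  obtain ⟨k, hk⟩ := (Ideal.span {ϖ}).exists_pow_inf_eq_pow_smul (LinearMap.range D)
  obtain ⟨a, rfl, ha⟩ := exists_idem_lift φ hφ hc hker' he k
  have hcomm : ∀ x, c ^ (k + 1) ∣ x * a - a * x := dvd_commutator hc ha fun x =>
    hker' _ (by rw [map_sub, map_mul, map_mul, hcen, sub_self])
  choose u hu using hcomm
  have hmem : D a ∈ (Ideal.span {ϖ}) ^ (k + 1) • (⊤ : Submodule R (s → A)) ⊓ LinearMap.range D := by
    refine ⟨?_, a, rfl⟩
    have : D a = ϖ ^ (k + 1) • fun i : s => u i := by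
      funext i
      rw [hD, hu, Pi.smul_apply, Algebra.smul_def, map_pow]
    rw [this]
    exact Submodule.smul_mem_smul (Ideal.pow_mem_pow (Ideal.mem_span_singleton_self _) _) trivial
  rw [hk _ (Nat.le_succ k), Nat.succ_sub (le_refl k), Nat.sub_self, Nat.succ_eq_add_one, zero_add,
    pow_one] at hmem
  have h := Submodule.smul_mono le_rfl inf_le_right hmem
  rw [Submodule.ideal_span_singleton_smul] at h
  obtain ⟨_, ⟨a', rfl⟩, h : ϖ • D a' = D a⟩ := h
  refine ⟨a - ϖ • a', ?_, ?_⟩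
  · have hz : D (a - ϖ • a') = 0 := by rw [map_sub, map_smul, h, sub_self]
    intro x
    have hx : x ∈ Submodule.span R (s : Set A) := hs ▸ Submodule.mem_top
    induction hx using Submodule.span_induction with
    | mem x hx => exact sub_eq_zero.1 (congrFun hz ⟨x, hx⟩)
    | zero => simp
    | add x y _ _ hx hy => rw [add_mul, mul_add, hx, hy]
    | smul r x _ hx => rw [smul_mul_assoc, mul_smul_comm, hx]
  · rw [map_sub, (hker _).2 ⟨a', rfl⟩, sub_zero]

end Lift

/-! ### Block idempotents -/

/-- The centre of a block is local: a central element that is not invertible on the block is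
nilpotent on it. -/
theorem IsBlockIdempotent.exists_pow_mul_eq_zero (K : Type*) [Field K] {A : Type*} [Ring A]
    [Algebra K A] [FiniteDimensional K A] {b : A} (hb : IsBlockIdempotent b) {M : Type*}
    [AddCommGroup M] [Module A M] (hM : LiesInBlock b M) {x : M} (hx : x ≠ 0) {f : A}
    (hf : ∀ a, a * f = f * a) (hfx : f • x = 0) : ∃ n : ℕ, f ^ n * b = 0 := by
  have : IsArtinianRing (Subalgebra.center K A) := .of_finite K _
  -- Fitting decomposition in the artinian centre: once the powers of `f` stabilise, `f ^ m * y ^ m`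
  -- is the idempotent onto the part where `f` is invertible.
  obtain ⟨n, y, hy⟩ := IsArtinian.exists_pow_succ_smul_dvd
    (⟨f, Subalgebra.mem_center_iff.2 hf⟩ : Subalgebra.center K A) (1 : Subalgebra.center K A)
  obtain ⟨y, hyc⟩ := y
  rw [Subalgebra.mem_center_iff] at hyc
  have h1 : f ^ (n + 1) * y = f ^ n := by
    have := congrArg Subtype.val hy
    simpa using this
  have h2 : ∀ j, f ^ (n + 1 + j) * y ^ j = f ^ (n + 1) := by
    intro j
    induction j with
    | zero => simp
    | succ j ih =>
      calc f ^ (n + 1 + (j + 1)) * y ^ (j + 1) = f ^ (j + 1) * (f ^ (n + 1) * y) * y ^ j := by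
            rw [pow_succ' y, ← mul_assoc, ← mul_assoc, ← pow_add]; congr 3; omega
        _ = _ := by rw [h1, ← pow_add, ← ih]; congr 2; omega
  have hfy : Commute f y := (hyc f)
  set m := n + 1 with hm
  have h3 : f ^ m * (f ^ m * y ^ m) = f ^ m := by rw [← mul_assoc, ← pow_add, h2]
  obtain ⟨e, he⟩ : ∃ e, e = f ^ m * y ^ m := ⟨_, rfl⟩
  rw [← he] at h3
  have hec : ∀ a, a * e = e * a := by
    intro a
    rw [he]
    have c1 : Commute a f := hf a
    have c2 : Commute a y := hyc a
    exact ((c1.pow_right m).mul_right (c2.pow_right m)).eq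
  have hee : e * e = e := by
    conv_lhs => rw [hec]
    conv_lhs => enter [1]; rw [he, (hfy.pow_pow m m).eq]
    rw [mul_assoc, h3, he, (hfy.pow_pow m m).eq]
  have hebc : ∀ a, a * (e * b) = e * b * a := by
    intro a
    rw [← mul_assoc, hec, mul_assoc, hb.central, mul_assoc]
  have hebb : e * b * b = e * b := by rw [mul_assoc, hb.idem]
  have hebe : e * b * (e * b) = e * b := by
    rw [mul_assoc, ← mul_assoc b, hec b, mul_assoc, hb.idem, ← mul_assoc, hee]
  refine ⟨m, ?_⟩
  -- Primitivity leaves two cases: `f` is nilpotent on the block, or `f` is invertible on it, which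
  -- `f • x = 0` with `x ≠ 0` forbids.
  rcases hb.primitive (e * b) hebe hebc hebb with h | h
  · rw [← h3, mul_assoc, h, mul_zero]
  · exfalso
    apply hx
    rw [← hM x, ← h, mul_smul, hM, he, (hfy.pow_pow m m).eq, hm, pow_succ f, ← mul_assoc, mul_smul,
      hfx, smul_zero]

/-- If every central idempotent acts on `M ≠ 0` as zero or as the identity, then `M` lies in a
block. -/
theorem exists_liesInBlock (K : Type*) [Field K] {A : Type*} [Ring A] [Algebra K A]
    [FiniteDimensional K A] (M : Type*) [AddCommGroup M] [Module A M] [Nontrivial M]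
    (h : ∀ e : A, e * e = e → (∀ a, a * e = e * a) → (∀ x : M, e • x = 0) ∨ ∀ x : M, e • x = x) :
    ∃ b : A, IsBlockIdempotent b ∧ LiesInBlock b M := by
  -- The block idempotent is a central idempotent `b` acting as the identity on `M` with `bA` of
  -- least dimension. For a central idempotent `e` below `b`, either `e` or `b - e` acts as the
  -- identity on `M`, and minimality makes it equal to `b`.
  let P : ℕ → Prop := fun d => ∃ e : A, e * e = e ∧ (∀ a, a * e = e * a) ∧ LiesInBlock e M ∧
    Module.finrank K (LinearMap.range (LinearMap.mulLeft K e)) = d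
  classical
  have hP : ∃ d, P d := ⟨_, 1, mul_one 1, fun a => by simp, fun x => one_smul A x, rfl⟩
  obtain ⟨b, hbb, hbc, hbM, hbd⟩ := Nat.find_spec hP
  have hmin : ∀ e : A, e * e = e → (∀ a, a * e = e * a) → e * b = e → LiesInBlock e M → e = b := by
    intro e hee hec heb heM
    have h1 := Nat.find_min' hP ⟨e, hee, hec, heM, rfl⟩
    have h2 : LinearMap.range (LinearMap.mulLeft K e) ≤ LinearMap.range (LinearMap.mulLeft K b) := by
      rintro _ ⟨a, rfl⟩
      refine ⟨e * a, ?_⟩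
      simp only [LinearMap.mulLeft_apply]
      rw [← mul_assoc, hec b, heb]
    have h3 := Submodule.eq_of_le_of_finrank_le h2 (hbd.trans_le h1)
    have h4 : b ∈ LinearMap.range (LinearMap.mulLeft K e) := by
      rw [h3]; exact ⟨1, mul_one b⟩
    obtain ⟨a, ha⟩ := h4
    rw [LinearMap.mulLeft_apply] at ha
    rw [← heb, ← ha, ← mul_assoc, hee]
  refine ⟨b, ⟨hbb, hbc, ?_, ?_⟩, hbM⟩
  · rintro rfl
    obtain ⟨x, hx⟩ := exists_ne (0 : M)
    exact hx (by rw [← hbM x, zero_smul])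
  · intro e hee hec heb
    rcases h e hee hec with h0 | h1
    · left
      have hbe : b * e = e := by rw [hec, heb]
      have := hmin (b - e) (by rw [sub_mul, mul_sub, mul_sub, hbb, hee, heb, hbe]; abel)
        (fun a => by rw [mul_sub, sub_mul, hbc, hec])
        (by rw [sub_mul, hbb, heb]) (fun x => by rw [sub_smul, hbM, h0, sub_zero])
      simpa using this
    · exact .inr (hmin e hee hec heb h1)

/-! ### Cancellation laws for diagrams -/

namespace Diagram

variable {α β : Type} {n m : ℕ}

/-- The reflection of a diagram in a horizontal line. -/
def flip (x : Diagram α β) : Diagram β α :=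
  ofInvolution (fun a => (x.partner a.swap).swap) (by intro a; simp [partner_partner])
    (by intro a h; exact x.partner_ne a.swap (by conv_rhs => rw [← h, Sum.swap_swap]))

theorem flip_rel (x : Diagram α β) {a b : α ⊕ β} (h : x.rel a b) : x.flip.rel a.swap b.swap := by
  rcases x.rel_iff.1 h with rfl | rfl
  · exact Setoid.refl' _ _
  · exact .inr (by simp)

/-- The edges of `v` close up into loops, which `comp` discards without a power of the parameter.
Half diagrams can therefore be cancelled even when the parameter is `0`. -/
theorem flip_toDiagram_comp (v : PartialDiagram n m) :
    v.toDiagram.flip.comp v.toDiagram = one (Fin m) := by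
  symm
  have hr : ∀ j, v.toDiagram.rel (.inr j) (.inl (v.free j : Fin n)) := fun j => .inr rfl
  have key : ∀ j, (v.toDiagram.flip.comp v.toDiagram).rel (.inl j) (.inr j) := fun j =>
    Setoid.trans' (glue _ _) (glue_left (flip_rel _ (hr j)))
      (glue_right (Setoid.symm' _ (hr j)))
  apply eq_of_rel_partner
  intro a
  rw [one, ofEquiv, partner_ofInvolution]
  rcases a with j | j
  · exact key j
  · exact Setoid.symm' _ (key j)

theorem Full.toDiagram (v : PartialDiagram n m) : v.toDiagram.Full := by
  have := toDiagram_comp_full v (Equiv.refl _)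
  rwa [← one, comp_one] at this

theorem Full.of_comp' {k : ℕ} {x : Diagram (Fin k) (Fin n)} {d : Diagram (Fin n) (Fin m)}
    (h : (x.comp d).Full) : d.Full := fun i j hij hd => h i j hij (glue_right (x := x) hd)

/-- Every middle node is joined through `d` to a top node, so no component lies wholly inside. -/
theorem Full.loops_eq_zero {d : Diagram (Fin n) (Fin m)} (h : d.Full)
    (y : Diagram (Fin m) β) : d.loops y = 0 := by
  refine innerCount_eq_zero _ _ ?_
  rintro (u | u | u)
  · exact ⟨.inl u, Setoid.refl' _ _⟩
  · obtain ⟨i, hi⟩ := h.exists u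
    have := glue_left (y := y) (d.rel_partner (.inr u))
    rw [hi] at this
    exact ⟨.inl i, Setoid.symm' _ this⟩
  · exact ⟨.inr u, Setoid.refl' _ _⟩

theorem Full.exists_ofEquiv {h : Diagram (Fin m) (Fin m)} (hh : h.Full) :
    ∃ g : Equiv.Perm (Fin m), h = ofEquiv g := by
  have hinj : Function.Injective fun j => (h.topEquiv hh j : Fin m) :=
    Subtype.val_injective.comp (h.topEquiv hh).injective
  refine ⟨Equiv.ofBijective _ (Finite.injective_iff_bijective.1 hinj), ?_⟩
  set g := Equiv.ofBijective _ (Finite.injective_iff_bijective.1 hinj) with hg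
  symm
  have key : ∀ j, h.rel (.inr j) (.inl (g j)) := by
    intro j
    have := h.rel_partner (.inr j)
    rwa [partner_inr h hh] at this
  apply eq_of_rel_partner
  intro a
  rw [ofEquiv, partner_ofInvolution]
  rcases a with j | j
  · have := Setoid.symm' _ (key (g.symm j))
    rwa [g.apply_symm_apply] at this
  · exact key j

theorem toDiagram_comp_injective {k : ℕ} (v : PartialDiagram n m) {d d' : Diagram (Fin m) (Fin k)}
    (h : v.toDiagram.comp d = v.toDiagram.comp d') : d = d' := by
  have := congrArg v.toDiagram.flip.comp h
  rwa [← comp_assoc, ← comp_assoc, flip_toDiagram_comp, one_comp, one_comp] at this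

theorem comp_flip_toDiagram_injective {k : ℕ} (w : PartialDiagram n m)
    {d d' : Diagram (Fin k) (Fin m)} (h : d.comp w.toDiagram.flip = d'.comp w.toDiagram.flip) :
    d = d' := by
  have := congrArg (fun e => e.comp w.toDiagram) h
  rwa [comp_assoc, comp_assoc, flip_toDiagram_comp, comp_one, comp_one] at this

theorem ofEquiv_comp_injective {k : ℕ} (g : Equiv.Perm (Fin m)) {d d' : Diagram (Fin m) (Fin k)}
    (h : (ofEquiv g).comp d = (ofEquiv g).comp d') : d = d' := by
  have := congrArg (ofEquiv g.symm).comp h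
  rw [← comp_assoc, ← comp_assoc, ofEquiv_comp_ofEquiv, Equiv.self_trans_symm] at this
  rwa [← one, one_comp, one_comp] at this

theorem comp_ofEquiv_injective {k : ℕ} (g : Equiv.Perm (Fin m)) {d d' : Diagram (Fin k) (Fin m)}
    (h : d.comp (ofEquiv g) = d'.comp (ofEquiv g)) : d = d' := by
  have := congrArg (fun e => e.comp (ofEquiv g.symm)) h
  rw [comp_assoc, comp_assoc, ofEquiv_comp_ofEquiv, Equiv.symm_trans_self] at this
  rwa [← one, comp_one, comp_one] at this

end Diagram

/-! ### Coefficients -/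

open Classical in
instance {n m : ℕ} : Fintype (Diagram (Fin n) (Fin m)) := Fintype.ofFinite _

namespace BrauerAlgebra

variable {F : Type*} [CommRing F] {n m : ℕ} {δ : F}

instance : Module.Free F (BrauerAlgebra F n δ) :=
  inferInstanceAs (Module.Free F (Diagram (Fin n) (Fin n) →₀ F))

instance : Module.Finite F (BrauerAlgebra F n δ) :=
  inferInstanceAs (Module.Finite F (Diagram (Fin n) (Fin n) →₀ F))

/-- The coefficient of a diagram. -/
def coeff (x : Diagram (Fin n) (Fin n)) : BrauerAlgebra F n δ →ₗ[F] F := Finsupp.lapply x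

open Classical in
theorem coeff_of (x y : Diagram (Fin n) (Fin n)) :
    coeff x (of δ y) = if y = x then 1 else 0 := Finsupp.single_apply

theorem ext_coeff {a b : BrauerAlgebra F n δ} (h : ∀ x, coeff x a = coeff x b) : a = b :=
  Finsupp.ext h

theorem sum_coeff (z : BrauerAlgebra F n δ) : ∑ u, coeff u z • of δ u = z := by
  classical
  apply ext_coeff
  intro x
  simp [coeff_of]

open Classical in
theorem coeff_mul_of (z : BrauerAlgebra F n δ) (x e : Diagram (Fin n) (Fin n)) :
    coeff e (z * of δ x) = ∑ u, if u.comp x = e then coeff u z * δ ^ u.loops x else 0 := by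
  conv_lhs => rw [← sum_coeff z, Finset.sum_mul, map_sum]
  refine Finset.sum_congr rfl fun u _ => ?_
  rw [smul_mul_assoc, of_mul_of, map_smul, map_smul, coeff_of]
  simp

open Classical in
theorem coeff_of_mul (z : BrauerAlgebra F n δ) (x e : Diagram (Fin n) (Fin n)) :
    coeff e (of δ x * z) = ∑ u, if x.comp u = e then coeff u z * δ ^ x.loops u else 0 := by
  conv_lhs => rw [← sum_coeff z, Finset.mul_sum, map_sum]
  refine Finset.sum_congr rfl fun u _ => ?_
  rw [mul_smul_comm, of_mul_of, map_smul, map_smul, coeff_of]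
  simp

open Classical in
/-- The coefficient of `d` in the product of `z` and the diagram `v`. -/
def leftCoeff (z : BrauerAlgebra F n δ) (v d : Diagram (Fin n) (Fin m)) : F :=
  ∑ u : Diagram (Fin n) (Fin n), if u.comp v = d then coeff u z * δ ^ u.loops v else 0

open Classical in
/-- The coefficient of `d` in the product of the diagram `y` and `z`. -/
def rightCoeff (z : BrauerAlgebra F n δ) (y d : Diagram (Fin m) (Fin n)) : F :=
  ∑ u : Diagram (Fin n) (Fin n), if y.comp u = d then coeff u z * δ ^ y.loops u else 0

/-- If `y` is right cancellable and `v`, `d` have no arcs in the bottom row, then the coefficient of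
`d` in `z v` is the coefficient of `d y` in `z v y`. -/
theorem leftCoeff_eq (z : BrauerAlgebra F n δ) {v d : Diagram (Fin n) (Fin m)} (hv : v.Full)
    (hd : d.Full) {y : Diagram (Fin m) (Fin n)}
    (hy : ∀ d' : Diagram (Fin n) (Fin m), d'.comp y = d.comp y → d' = d) :
    leftCoeff z v d = coeff (d.comp y) (z * of δ (v.comp y)) := by
  rw [coeff_mul_of, leftCoeff]
  refine Finset.sum_congr rfl fun u _ => ?_
  rw [← Diagram.comp_assoc]
  by_cases h : u.comp v = d
  · have := Diagram.loops_assoc u v y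
    rw [h, hd.loops_eq_zero, hv.loops_eq_zero, add_zero, zero_add] at this
    rw [if_pos h, if_pos (by rw [h]), this]
  · rw [if_neg h, if_neg fun h' => h (hy _ h')]

/-- The half diagram `v` on the left is cancellable and creates no loops, so it drops out. This is
why the coefficients in `z v` do not depend on `v`. -/
theorem coeff_comp_mul (z : BrauerAlgebra F n δ) (v : PartialDiagram n m)
    (h : Diagram (Fin m) (Fin m)) (y : Diagram (Fin m) (Fin n)) :
    coeff ((v.toDiagram.comp h).comp y) (of δ (v.toDiagram.comp y) * z) =
      rightCoeff z y (h.comp y) := by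
  rw [coeff_of_mul, rightCoeff]
  refine Finset.sum_congr rfl fun u _ => ?_
  rw [Diagram.comp_assoc, Diagram.comp_assoc]
  have := Diagram.loops_assoc v.toDiagram y u
  rw [(Diagram.Full.toDiagram v).loops_eq_zero, (Diagram.Full.toDiagram v).loops_eq_zero, add_zero,
    zero_add] at this
  rw [this]
  by_cases h' : y.comp u = h.comp y
  · rw [if_pos h', if_pos (by rw [h'])]
  · rw [if_neg h', if_neg fun h'' => h' (Diagram.toDiagram_comp_injective v h'')]

/-! ### Products of central elements with half diagrams -/

section Central

variable {z : BrauerAlgebra F n δ} (v w : PartialDiagram n m)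

/-- A central element multiplies `v` by a combination of permutations that does not depend on
`v`. -/
theorem leftCoeff_toDiagram_comp (hz : ∀ a, a * z = z * a) (g : Equiv.Perm (Fin m)) :
    leftCoeff z v.toDiagram (v.toDiagram.comp (Diagram.ofEquiv g)) =
      rightCoeff z w.toDiagram.flip ((Diagram.ofEquiv g).comp w.toDiagram.flip) := by
  rw [leftCoeff_eq z (Diagram.Full.toDiagram v) (Diagram.toDiagram_comp_full v g)
    (y := w.toDiagram.flip) (fun d' h => Diagram.comp_flip_toDiagram_injective w h), ← hz,
    coeff_comp_mul]

/-- If `d v*` occurs in `z (v v*) = (v v*) z`, then `d v* = v v* u` for some `u`, and multiplying by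
`v` gives `d = v (v* u v)`. As `d` is full, so is `v* u v`, which is then a permutation. -/
theorem leftCoeff_eq_zero (hz : ∀ a, a * z = z * a) {d : Diagram (Fin n) (Fin m)} (hd : d.Full)
    (h : ∀ g : Equiv.Perm (Fin m), d ≠ v.toDiagram.comp (Diagram.ofEquiv g)) :
    leftCoeff z v.toDiagram d = 0 := by
  rw [leftCoeff_eq z (Diagram.Full.toDiagram v) hd (y := v.toDiagram.flip)
    (fun d' h => Diagram.comp_flip_toDiagram_injective v h), ← hz, coeff_of_mul]
  refine Finset.sum_eq_zero fun u _ => if_neg fun hu => ?_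
  have h1 : d = v.toDiagram.comp ((v.toDiagram.flip.comp u).comp v.toDiagram) := by
    have := congrArg (fun e => e.comp v.toDiagram) hu
    rw [Diagram.comp_assoc d, Diagram.flip_toDiagram_comp, Diagram.comp_one] at this
    rw [← this]
    simp only [Diagram.comp_assoc]
  obtain ⟨g, hg⟩ := Diagram.Full.exists_ofEquiv (Diagram.Full.of_comp' (h1 ▸ hd))
  exact h g (by rw [← hg, ← h1])

/-- The coefficient of `w (g h g⁻¹)` in `z w` can be read off after multiplying by any cancellable
half diagram. Taking `g w*` instead of `w*` turns `g h g⁻¹` into `g h`, and the `g` on the left then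
cancels. -/
theorem rightCoeff_conj (hz : ∀ a, a * z = z * a) (g h : Equiv.Perm (Fin m)) :
    rightCoeff z w.toDiagram.flip ((Diagram.ofEquiv (g * h * g⁻¹)).comp w.toDiagram.flip) =
      rightCoeff z w.toDiagram.flip ((Diagram.ofEquiv h).comp w.toDiagram.flip) := by
  have hm : ∀ a b : Equiv.Perm (Fin m), (Diagram.ofEquiv a).comp (Diagram.ofEquiv b) =
      Diagram.ofEquiv (a * b) := fun a b => Diagram.ofEquiv_comp_ofEquiv a b
  rw [← leftCoeff_toDiagram_comp w w hz]
  rw [leftCoeff_eq z (Diagram.Full.toDiagram w) (Diagram.toDiagram_comp_full w _)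
    (y := (Diagram.ofEquiv g).comp w.toDiagram.flip) (fun d' h => by
      rw [← Diagram.comp_assoc, ← Diagram.comp_assoc] at h
      exact Diagram.comp_ofEquiv_injective g (Diagram.comp_flip_toDiagram_injective w h)), ← hz,
    coeff_comp_mul, rightCoeff, rightCoeff]
  refine Finset.sum_congr rfl fun u _ => ?_
  have hl := Diagram.loops_assoc (Diagram.ofEquiv g) w.toDiagram.flip u
  rw [Diagram.ofEquiv_loops, Diagram.ofEquiv_loops, add_zero, zero_add] at hl
  rw [hl, ← Diagram.comp_assoc (Diagram.ofEquiv (g * h * g⁻¹)), hm, inv_mul_cancel_right, ← hm,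
    Diagram.comp_assoc, Diagram.comp_assoc]
  by_cases h' : w.toDiagram.flip.comp u = (Diagram.ofEquiv h).comp w.toDiagram.flip
  · rw [if_pos h', if_pos (by rw [h'])]
  · rw [if_neg h', if_neg fun h'' => h' (Diagram.ofEquiv_comp_injective g h'')]

end Central

end BrauerAlgebra

/-! ### The action of central elements on cell modules -/

namespace CellModule

variable {F : Type*} [CommRing F] {n : ℕ} {δ : F} {lam : YoungDiagram}

open Classical in
/-- The element of the cell module given by a diagram and an element of the Specht module. -/
def ofDiagram (δ : F) (d : Diagram (Fin n) (Fin lam.card)) (s : SpechtModule F lam) :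
    CellModule F n δ lam :=
  if h : d.Full then tmul δ (d.topRow h) (spechtRep F lam (d.freePerm h) s) else 0

theorem of_smul_tmul (u : Diagram (Fin n) (Fin n)) (v : PartialDiagram n lam.card)
    (s : SpechtModule F lam) : BrauerAlgebra.of δ u • tmul δ v s =
      δ ^ u.loops v.toDiagram • ofDiagram δ (u.comp v.toDiagram) s := by
  have : BrauerAlgebra.of δ u • tmul δ v s = act δ u (tmul δ v s) := by
    rw [smul_def]
    exact congrArg (fun f : Module.End F (CellModule F n δ lam) => f (tmul δ v s))
      (BrauerAlgebra.lin_of (act δ) u)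
  rw [this, ofDiagram]
  split_ifs with h
  · rw [act_tmul_of_full h]
  · rw [act_tmul_of_not_full h, smul_zero]

theorem ofDiagram_comp (v : PartialDiagram n lam.card) (g : Equiv.Perm (Fin lam.card))
    (s : SpechtModule F lam) : ofDiagram δ (v.toDiagram.comp (Diagram.ofEquiv g)) s =
      tmul δ v (spechtRep F lam g s) := by
  rw [ofDiagram, dif_pos (Diagram.toDiagram_comp_full v g), Diagram.topRow_toDiagram_comp,
    Diagram.freePerm_toDiagram_comp]

instance : IsScalarTower F (BrauerAlgebra F n δ) (CellModule F n δ lam) where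
  smul_assoc r a x := by
    rw [smul_def, smul_def]
    exact congrArg (fun f => f x) (map_smul (BrauerAlgebra.lin δ (act δ (lam := lam))) r a)

theorem smul_tmul (z : BrauerAlgebra F n δ) (v : PartialDiagram n lam.card)
    (s : SpechtModule F lam) :
    z • tmul δ v s = ∑ d, z.leftCoeff v.toDiagram d • ofDiagram δ d s := by
  classical
  conv_lhs => rw [← BrauerAlgebra.sum_coeff z, Finset.sum_smul]
  simp only [BrauerAlgebra.leftCoeff, Finset.sum_smul]
  rw [Finset.sum_comm]
  refine Finset.sum_congr rfl fun u _ => ?_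
  simp only [ite_smul, zero_smul, Finset.sum_ite_eq, Finset.mem_univ, if_true]
  rw [smul_assoc, of_smul_tmul, smul_smul]

/-- A central element of the Brauer algebra acts on a cell module through a class function on the
symmetric group. -/
theorem central_smul_tmul {z : BrauerAlgebra F n δ} (hz : ∀ a, a * z = z * a) :
    ∃ ζ : Equiv.Perm (Fin lam.card) → F, (∀ g h, ζ (g * h * g⁻¹) = ζ h) ∧
      ∀ (v : PartialDiagram n lam.card) (s : SpechtModule F lam),
        z • tmul δ v s = tmul δ v (∑ g, ζ g • spechtRep F lam g s) := by
  classical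
  by_cases hw : Nonempty (PartialDiagram n lam.card)
  swap
  · exact ⟨0, fun _ _ => rfl, fun v => (hw ⟨v⟩).elim⟩
  obtain ⟨w⟩ := hw
  -- One reference half diagram `w` defines the class function for all `v` at once.
  refine ⟨fun g => z.rightCoeff w.toDiagram.flip ((Diagram.ofEquiv g).comp w.toDiagram.flip),
    BrauerAlgebra.rightCoeff_conj w hz, fun v s => ?_⟩
  rw [smul_tmul, map_sum]
  symm
  refine Finset.sum_of_injOn (fun g => v.toDiagram.comp (Diagram.ofEquiv g)) ?_ (by simp) ?_ ?_
  · intro g _ g' _ h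
    have h1 := Diagram.freePerm_toDiagram_comp v g (Diagram.toDiagram_comp_full v g)
    exact h1.symm.trans ((Diagram.topRow_freePerm_of_eq _ v g' h).2)
  · intro d _ hd
    by_cases hf : d.Full
    · rw [BrauerAlgebra.leftCoeff_eq_zero v hz hf, zero_smul]
      rintro g rfl
      exact hd ⟨g, by simp, rfl⟩
    · rw [ofDiagram, dif_neg hf, smul_zero]
  · intro g _
    rw [ofDiagram_comp, map_smul, BrauerAlgebra.leftCoeff_toDiagram_comp v w hz]

end CellModule

/-! ### Class functions act on Specht modules as scalars -/

section ClassFunction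

variable (F : Type*) [CommRing F] (lam : YoungDiagram)

theorem tabloidRep_single {m : ℕ} (g : Equiv.Perm (Fin m)) (r : Fin m → ℕ) (a : F) :
    tabloidRep F m g (Finsupp.single r a) = Finsupp.single (r ∘ ⇑g⁻¹) a := by
  simp [tabloidRep, Finsupp.mapDomain_single]

/-- The signed sum of the column stabiliser, as an endomorphism of the permutation module. -/
def colAntisymm (t : Fin lam.card ≃ lam.cells) : Module.End F ((Fin lam.card → ℕ) →₀ F) :=
  ∑ s ∈ colStab lam t, ((Equiv.Perm.sign s : ℤ) : F) • tabloidRep F lam.card s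

theorem colAntisymm_single_tabloid (t : Fin lam.card ≃ lam.cells) :
    colAntisymm F lam t (Finsupp.single (tabloid lam t) 1) = polytabloid F lam t := by
  simp [colAntisymm, polytabloid]

variable {lam}

theorem mem_colStab {t : Fin lam.card ≃ lam.cells} {s : Equiv.Perm (Fin lam.card)} :
    s ∈ colStab lam t ↔ ∀ i, (t (s i)).1.2 = (t i).1.2 := by
  simp [colStab]

theorem mul_mem_colStab {t : Fin lam.card ≃ lam.cells} {s s' : Equiv.Perm (Fin lam.card)}
    (h : s ∈ colStab lam t) (h' : s' ∈ colStab lam t) : s * s' ∈ colStab lam t := by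
  rw [mem_colStab] at *
  intro i
  rw [Equiv.Perm.mul_apply, h, h']

theorem inv_mem_colStab {t : Fin lam.card ≃ lam.cells} {s : Equiv.Perm (Fin lam.card)}
    (h : s ∈ colStab lam t) : s⁻¹ ∈ colStab lam t := by
  rw [mem_colStab] at *
  intro i
  have := h (s⁻¹ i)
  rw [show s (s⁻¹ i) = i from s.apply_symm_apply i] at this
  exact this.symm

theorem swap_mem_colStab {t : Fin lam.card ≃ lam.cells} {i j : Fin lam.card}
    (h : (t i).1.2 = (t j).1.2) : Equiv.swap i j ∈ colStab lam t := by
  rw [mem_colStab]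
  intro k
  rcases em (k = i) with rfl | hi
  · rw [Equiv.swap_apply_left, h]
  · rcases em (k = j) with rfl | hj
    · rw [Equiv.swap_apply_right, h]
    · rw [Equiv.swap_apply_of_ne_of_ne hi hj]

/-- A row assignment that is constant on two entries of a column is killed by the signed column
sum. -/
theorem colAntisymm_single_eq_zero {t : Fin lam.card ≃ lam.cells} {r : Fin lam.card → ℕ}
    {i j : Fin lam.card} (hij : i ≠ j) (hc : (t i).1.2 = (t j).1.2) (hr : r i = r j) :
    colAntisymm F lam t (Finsupp.single r 1) = 0 := by
  have hswap : r ∘ Equiv.swap i j = r := by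
    funext k
    rcases em (k = i) with rfl | hi
    · simp [hr]
    · rcases em (k = j) with rfl | hj
      · simp [hr]
      · simp [Equiv.swap_apply_of_ne_of_ne hi hj]
  rw [colAntisymm, LinearMap.sum_apply]
  -- The terms cancel in pairs of opposite sign; nothing is divided by `2`, so characteristic `2` is
  -- covered.
  refine Finset.sum_involution (fun s _ => s * Equiv.swap i j) ?_ ?_ ?_ ?_
  · intro s _
    rw [LinearMap.smul_apply, LinearMap.smul_apply, tabloidRep_single, tabloidRep_single,
      Equiv.Perm.sign_mul, Equiv.Perm.sign_swap hij, mul_inv_rev, Equiv.swap_inv,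
      Equiv.Perm.coe_mul, ← Function.comp_assoc, hswap]
    simp
  · intro s _ _ h
    exact hij (Equiv.swap_eq_one_iff.1 (mul_eq_left.1 h))
  · intro s hs
    exact mul_mem_colStab hs (swap_mem_colStab hc)
  · intro s _
    rw [mul_assoc, Equiv.swap_mul_self, mul_one]

theorem colAntisymm_mul {t : Fin lam.card ≃ lam.cells} {σ : Equiv.Perm (Fin lam.card)}
    (hσ : σ ∈ colStab lam t) : colAntisymm F lam t * tabloidRep F lam.card σ =
      ((Equiv.Perm.sign σ : ℤ) : F) • colAntisymm F lam t := by
  rw [colAntisymm, Finset.sum_mul, Finset.smul_sum]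
  refine Finset.sum_bij' (fun s _ => s * σ) (fun s _ => s * σ⁻¹)
    (fun s hs => mul_mem_colStab hs hσ) (fun s hs => mul_mem_colStab hs (inv_mem_colStab hσ))
    (by simp) (by simp) ?_
  intro s _
  rw [smul_mul_assoc, ← map_mul, smul_smul, Equiv.Perm.sign_mul, Units.val_mul, Int.cast_mul,
    ← mul_assoc, mul_right_comm, ← Int.cast_mul, ← Units.val_mul, Int.units_mul_self]
  simp

/-- A rearrangement of a tabloid of shape `lam` which is injective on the columns of the tableau `t`
is a column permutation of the tabloid of `t`. -/
theorem exists_colStab_of_injOn {t : Fin lam.card ≃ lam.cells} (g : Equiv.Perm (Fin lam.card))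
    (h : ∀ i j, (t i).1.2 = (t j).1.2 → tabloid lam t (g i) = tabloid lam t (g j) → i = j) :
    ∃ σ ∈ colStab lam t, tabloid lam t ∘ g = tabloid lam t ∘ σ := by
  classical
  set r : Fin lam.card → ℕ := fun i => tabloid lam t (g i) with hr
  -- Entries with new row below `k`, the length of column `c₀`, are as many as those with old row
  -- below `k`. In each column there are at most as many of the former: a column of length at most
  -- `k` lies wholly in `S`, and a longer one has `k` entries in `S` while `r` is injective on it.
  -- So equality holds columnwise, and all of column `c₀` has new row below `k`.
  have hcell : ∀ i, (r i, (t i).1.2) ∈ lam.cells := by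
    intro i₀
    set c₀ := (t i₀).1.2 with hc₀
    set k := lam.colLen c₀ with hk
    set C := Finset.univ.image fun i => (t i).1.2 with hC
    set S := Finset.univ.filter fun i => tabloid lam t i < k with hS
    set S' := Finset.univ.filter fun i => r i < k with hS'
    have hcard : S'.card = S.card := by
      refine Finset.card_bij (fun i _ => g i) ?_ ?_ ?_
      · intro i hi
        simpa [hS, hS', hr] using hi
      · intro i _ j _ hij
        exact g.injective hij
      · intro j hj
        exact ⟨g.symm j, by simpa [hS, hS', hr] using hj, by simp⟩
    have hmap : ∀ T : Finset (Fin lam.card), ∀ i ∈ T, (t i).1.2 ∈ C := fun T i _ =>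
      Finset.mem_image_of_mem _ (Finset.mem_univ i)
    have hle : ∀ c ∈ C, (S'.filter fun i => (t i).1.2 = c).card ≤
        (S.filter fun i => (t i).1.2 = c).card := by
      intro c _
      by_cases hck : lam.colLen c ≤ k
      · refine Finset.card_le_card fun i hi => ?_
        rw [Finset.mem_filter] at hi ⊢
        refine ⟨?_, hi.2⟩
        rw [hS, Finset.mem_filter]
        refine ⟨Finset.mem_univ _, lt_of_lt_of_le ?_ hck⟩
        rw [← hi.2]
        exact YoungDiagram.mem_iff_lt_colLen.1 ((YoungDiagram.mem_cells _).1 (t i).2)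
      · push Not at hck
        calc _ ≤ (Finset.range k).card := by
              refine Finset.card_le_card_of_injOn r ?_ ?_
              · intro i hi
                simp only [hS', Finset.coe_filter, Finset.mem_filter, Set.mem_ofPred_eq] at hi
                simpa using hi.1
              · intro i hi j hj hij
                simp only [Finset.coe_filter, Set.mem_ofPred_eq] at hi hj
                exact h i j (hi.2.trans hj.2.symm) hij
          _ ≤ _ := by
              have hmem : ∀ j ∈ Finset.range k, (j, c) ∈ lam.cells := fun j hj =>
                (YoungDiagram.mem_cells _).2
                  (YoungDiagram.mem_iff_lt_colLen.2 ((Finset.mem_range.1 hj).trans hck))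
              refine Finset.card_le_card_of_forall_subsingleton
                (fun j i => (t i).1 = (j, c)) ?_ ?_
              · intro j hj
                exact ⟨t.symm ⟨_, hmem j hj⟩, Finset.mem_filter.2 ⟨Finset.mem_filter.2
                  ⟨Finset.mem_univ _, by simpa [tabloid] using hj⟩, by simp⟩, by simp⟩
              · intro i _ j hj j' hj'
                have := hj.2.symm.trans hj'.2
                simpa using this
    have hsum := (Finset.sum_eq_sum_iff_of_le hle).1 (by
      rw [← Finset.card_eq_sum_card_fiberwise (hmap S'),
        ← Finset.card_eq_sum_card_fiberwise (hmap S), hcard])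
    have h0 := hsum c₀ (Finset.mem_image_of_mem _ (Finset.mem_univ i₀))
    have h1 : (S.filter fun i => (t i).1.2 = c₀) = Finset.univ.filter fun i => (t i).1.2 = c₀ := by
      ext i
      simp only [hS, Finset.mem_filter, Finset.mem_univ, true_and, and_iff_right_iff_imp]
      intro hi
      rw [hk, ← hi]
      exact YoungDiagram.mem_iff_lt_colLen.1 ((YoungDiagram.mem_cells _).1 (t i).2)
    have h2 : (S'.filter fun i => (t i).1.2 = c₀) = Finset.univ.filter fun i => (t i).1.2 = c₀ := by
      refine Finset.eq_of_subset_of_card_le (Finset.filter_subset_filter _ (Finset.subset_univ _)) ?_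
      rw [h0, h1]
    have h3 : i₀ ∈ S'.filter fun i => (t i).1.2 = c₀ := by
      rw [h2]; simp [hc₀]
    simp only [hS', Finset.mem_filter, Finset.mem_univ, true_and] at h3
    exact (YoungDiagram.mem_cells _).2 (YoungDiagram.mem_iff_lt_colLen.2 h3.1)
  -- The column permutation sends `i` to the entry of `t` in the column of `i` and the row of `g i`.
  let f : Fin lam.card → Fin lam.card := fun i => t.symm ⟨(r i, (t i).1.2), hcell i⟩
  have hf : ∀ i, (t (f i)).1 = (r i, (t i).1.2) := fun i => by simp [f]
  have hinj : Function.Injective f := by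
    intro i j hij
    have := (hf i).symm.trans ((congrArg (fun k => (t k).1) hij).trans (hf j))
    rw [Prod.mk.injEq] at this
    exact h i j this.2 this.1
  refine ⟨Equiv.ofBijective f (Finite.injective_iff_bijective.1 hinj), ?_, ?_⟩
  · rw [mem_colStab]
    intro i
    rw [Equiv.ofBijective_apply, hf]
  · funext i
    rw [Function.comp_apply, Function.comp_apply, Equiv.ofBijective_apply]
    change r i = (t (f i)).1.1
    rw [hf]

/-- Either two entries of one column share a row and the signed sum vanishes, or the tabloid is a
column permutation of that of `t` and only a sign appears. -/
theorem exists_colAntisymm_single (t : Fin lam.card ≃ lam.cells) (g : Equiv.Perm (Fin lam.card)) :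
    ∃ c : F, colAntisymm F lam t (Finsupp.single (tabloid lam t ∘ g) 1) =
      c • polytabloid F lam t := by
  by_cases h : ∀ i j, (t i).1.2 = (t j).1.2 → tabloid lam t (g i) = tabloid lam t (g j) → i = j
  · obtain ⟨σ, hσ, e⟩ := exists_colStab_of_injOn g h
    refine ⟨((Equiv.Perm.sign σ⁻¹ : ℤ) : F), ?_⟩
    rw [e]
    have h1 : (Finsupp.single (tabloid lam t ∘ σ) (1 : F)) =
        tabloidRep F lam.card σ⁻¹ (Finsupp.single (tabloid lam t) 1) := by
      rw [tabloidRep_single, inv_inv]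
    rw [h1, ← Module.End.mul_apply, colAntisymm_mul F (inv_mem_colStab hσ), LinearMap.smul_apply,
      colAntisymm_single_tabloid]
  · push Not at h
    obtain ⟨i, j, hc, hr, hij⟩ := h
    exact ⟨0, by rw [zero_smul, colAntisymm_single_eq_zero F hij hc hr]⟩

variable (lam)

/-- The operator of `ζ` commutes with the symmetric group, hence with the signed column sum, so one
polytabloid is an eigenvector. The group permutes the polytabloids transitively, so the eigenvalue
is the same for all. -/
theorem exists_classFunction_smul {ζ : Equiv.Perm (Fin lam.card) → F}
    (hζ : ∀ g h, ζ (g * h * g⁻¹) = ζ h) :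
    ∃ c : F, ∀ s : SpechtModule F lam, ∑ g, ζ g • spechtRep F lam g s = c • s := by
  set Z : Module.End F ((Fin lam.card → ℕ) →₀ F) := ∑ g, ζ g • tabloidRep F lam.card g with hZ
  have hcomm : ∀ h, tabloidRep F lam.card h * Z = Z * tabloidRep F lam.card h := by
    intro h
    rw [hZ, Finset.mul_sum, Finset.sum_mul]
    refine Fintype.sum_equiv (MulAut.conj h).toEquiv _ _ fun g => ?_
    simp only [MulEquiv.toEquiv_eq_coe, MulEquiv.coe_toEquiv, MulAut.conj_apply]
    rw [hζ, mul_smul_comm, smul_mul_assoc, ← map_mul, ← map_mul, inv_mul_cancel_right]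
  let t : Fin lam.card ≃ lam.cells := lam.cells.equivFin.symm
  have hcE : colAntisymm F lam t * Z = Z * colAntisymm F lam t := by
    exact (Commute.sum_left _ _ _ fun s _ =>
      (show Commute (tabloidRep F lam.card s) Z from hcomm s).smul_left _).eq
  choose c hc using fun g => exists_colAntisymm_single F t g
  have ht : Z (polytabloid F lam t) = (∑ g, ζ g * c g⁻¹) • polytabloid F lam t := by
    rw [← colAntisymm_single_tabloid, ← Module.End.mul_apply, ← hcE, Module.End.mul_apply, hZ,
      LinearMap.sum_apply, map_sum, Finset.sum_smul]
    refine Finset.sum_congr rfl fun g _ => ?_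
    rw [LinearMap.smul_apply, map_smul, tabloidRep_single, hc, colAntisymm_single_tabloid, mul_smul]
  have hall : ∀ x ∈ Specht F lam, Z x = (∑ g, ζ g * c g⁻¹) • x := by
    intro x hx
    induction hx using Submodule.span_induction with
    | mem x h =>
      obtain ⟨t', rfl⟩ := h
      have e : polytabloid F lam t' =
          tabloidRep F lam.card (t.trans t'.symm) (polytabloid F lam t) := by
        rw [tabloidRep_polytabloid]
        congr 1
        ext i : 1
        simp
      rw [e, ← Module.End.mul_apply, ← hcomm, Module.End.mul_apply, ht, map_smul]
    | zero => simp
    | add x y _ _ hx hy => rw [map_add, hx, hy, smul_add]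
    | smul a x _ hx => rw [map_smul, hx, smul_comm]
  refine ⟨∑ g, ζ g * c g⁻¹, fun s => ?_⟩
  apply Subtype.ext
  have h1 := hall s.1 s.2
  rw [hZ, LinearMap.sum_apply] at h1
  refine Eq.trans ?_ h1
  exact map_sum (Specht F lam).subtype (fun g => ζ g • spechtRep F lam g s) Finset.univ

/-- A polytabloid involves its own tabloid with coefficient one. -/
theorem polytabloid_apply_tabloid (t : Fin lam.card ≃ lam.cells) :
    polytabloid F lam t (tabloid lam t) = 1 := by
  classical
  rw [polytabloid, Finsupp.finsetSum_apply, Finset.sum_eq_single 1]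
  · simp
  · intro s hs hs1
    -- A column permutation that fixes the tabloid preserves the row and column of every entry, so
    -- it is trivial.
    rw [Finsupp.smul_apply, tabloidRep_single, Finsupp.single_apply, if_neg, smul_zero]
    intro h
    apply hs1
    have hs' := mem_colStab.1 hs
    ext1 i
    apply t.injective
    apply Subtype.ext
    refine Prod.ext ?_ (hs' i)
    have := congrFun h (s i)
    simpa [tabloid] using this.symm
  · intro h
    exact absurd (mem_colStab.2 fun i => rfl) h

end ClassFunction

/-! ### Change of the ground ring -/

namespace BrauerAlgebra

variable {F F' : Type*} [CommRing F] [CommRing F'] {n m : ℕ} {δ : F}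

theorem coeff_mul (a b : BrauerAlgebra F n δ) (e : Diagram (Fin n) (Fin n)) :
    coeff e (a * b) = ∑ y, coeff y b * leftCoeff a y e := by
  conv_lhs => rw [← sum_coeff b, Finset.mul_sum, map_sum]
  refine Finset.sum_congr rfl fun y _ => ?_
  rw [mul_smul_comm, map_smul, coeff_mul_of, leftCoeff, smul_eq_mul]

/-- Applying a ring homomorphism to the coefficients. -/
def mapCoeff (f : F →+* F') (a : BrauerAlgebra F n δ) : BrauerAlgebra F' n (f δ) :=
  Finsupp.mapRange f (map_zero f) a

theorem coeff_mapCoeff (f : F →+* F') (a : BrauerAlgebra F n δ) (x : Diagram (Fin n) (Fin n)) :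
    coeff x (mapCoeff f a) = f (coeff x a) :=
  Finsupp.mapRange_apply (hf := map_zero f)

theorem leftCoeff_mapCoeff (f : F →+* F') (a : BrauerAlgebra F n δ)
    (v d : Diagram (Fin n) (Fin m)) : leftCoeff (mapCoeff f a) v d = f (leftCoeff a v d) := by
  classical
  rw [leftCoeff, leftCoeff, map_sum]
  refine Finset.sum_congr rfl fun u _ => ?_
  rw [apply_ite f, map_mul, map_pow, map_zero, coeff_mapCoeff]

theorem mapCoeff_of (f : F →+* F') (x : Diagram (Fin n) (Fin n)) :
    mapCoeff f (of δ x) = of (f δ) x := by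
  classical
  refine ext_coeff fun y => ?_
  rw [coeff_mapCoeff, coeff_of, coeff_of, apply_ite f, map_one, map_zero]

/-- The homomorphism of Brauer algebras induced by a homomorphism of the ground rings. -/
def baseChange (f : F →+* F') (n : ℕ) (δ : F) :
    BrauerAlgebra F n δ →+* BrauerAlgebra F' n (f δ) where
  toFun := mapCoeff f
  map_one' := mapCoeff_of f _
  map_zero' := ext_coeff fun x => by rw [coeff_mapCoeff, map_zero, map_zero, map_zero]
  map_add' a b := ext_coeff fun x => by
    rw [map_add, coeff_mapCoeff, coeff_mapCoeff, coeff_mapCoeff, map_add, map_add]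
  map_mul' a b := ext_coeff fun x => by
    rw [coeff_mapCoeff, coeff_mul, coeff_mul, map_sum]
    refine Finset.sum_congr rfl fun y _ => ?_
    rw [map_mul, leftCoeff_mapCoeff, coeff_mapCoeff]

theorem baseChange_apply (f : F →+* F') (a : BrauerAlgebra F n δ) :
    baseChange f n δ a = mapCoeff f a := rfl

theorem baseChange_surjective {f : F →+* F'} (hf : Function.Surjective f) :
    Function.Surjective (baseChange f n δ) :=
  Finsupp.mapRange_surjective f (map_zero f) hf

theorem baseChange_eq_zero_iff {f : F →+* F'} {ϖ : F} (hf : ∀ r, f r = 0 ↔ ϖ ∣ r)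
    (a : BrauerAlgebra F n δ) : baseChange f n δ a = 0 ↔ ∃ y, a = ϖ • y := by
  constructor
  · intro h
    have h1 : ∀ x, ϖ ∣ coeff x a := fun x => by
      rw [← hf, ← coeff_mapCoeff, ← baseChange_apply, h, map_zero]
    choose c hc using h1
    refine ⟨∑ x, c x • of δ x, ?_⟩
    rw [Finset.smul_sum]
    conv_lhs => rw [← sum_coeff a]
    refine Finset.sum_congr rfl fun x _ => ?_
    rw [smul_smul, ← hc]
  · rintro ⟨y, rfl⟩
    refine ext_coeff fun x => ?_
    rw [baseChange_apply, coeff_mapCoeff, map_smul, map_zero, smul_eq_mul, hf]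
    exact dvd_mul_right _ _

/-- Commuting with diagrams suffices, and these come from the algebra over `F`; so `f` need not be
surjective, as for the inclusion of `R` in `K`. -/
theorem baseChange_central (f : F →+* F') {z : BrauerAlgebra F n δ} (hz : ∀ a, a * z = z * a)
    (a : BrauerAlgebra F' n (f δ)) : a * baseChange f n δ z = baseChange f n δ z * a := by
  rw [← sum_coeff a, Finset.sum_mul, Finset.mul_sum]
  refine Finset.sum_congr rfl fun x _ => ?_
  rw [smul_mul_assoc, mul_smul_comm, ← mapCoeff_of f x, ← baseChange_apply, ← map_mul, hz, map_mul]

end BrauerAlgebra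

/-! ### Specht modules under change of ground ring -/

section Specht

variable {F F' : Type*} [CommRing F] [CommRing F'] (f : F →+* F') (lam : YoungDiagram)

theorem mapRange_tabloidRep {m : ℕ} (g : Equiv.Perm (Fin m)) (x : (Fin m → ℕ) →₀ F) :
    Finsupp.mapRange f (map_zero f) (tabloidRep F m g x) =
      tabloidRep F' m g (Finsupp.mapRange f (map_zero f) x) :=
  (Finsupp.mapDomain_mapRange _ x f (map_zero f) (map_add f)).symm

theorem mapRange_polytabloid (t : Fin lam.card ≃ lam.cells) :
    Finsupp.mapRange f (map_zero f) (polytabloid F lam t) = polytabloid F' lam t := by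
  change Finsupp.mapRange.addMonoidHom (f : F →+ F') (polytabloid F lam t) = _
  rw [polytabloid, polytabloid, map_sum]
  refine Finset.sum_congr rfl fun s _ => ?_
  change Finsupp.mapRange f (map_zero f) _ = _
  rw [Finsupp.mapRange_smul' (hf := map_zero f) _ (f _) _ fun b => f.map_mul _ b,
    mapRange_tabloidRep, Finsupp.mapRange_single, map_one, map_intCast]

theorem mapRange_mem_Specht {x : (Fin lam.card → ℕ) →₀ F} (hx : x ∈ Specht F lam) :
    Finsupp.mapRange f (map_zero f) x ∈ Specht F' lam := by
  induction hx using Submodule.span_induction with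
  | mem x h =>
    obtain ⟨t, rfl⟩ := h
    rw [mapRange_polytabloid]
    exact Submodule.subset_span ⟨t, rfl⟩
  | zero => simp
  | add x y _ _ hx hy =>
    rw [Finsupp.mapRange_add (map_add f)]
    exact add_mem hx hy
  | smul a x _ hx =>
    rw [Finsupp.mapRange_smul' a (f a) x fun b => f.map_mul a b]
    exact Submodule.smul_mem _ _ hx

/-- The semilinear map of Specht modules induced by a homomorphism of the ground rings. -/
def spechtMap : SpechtModule F lam →ₛₗ[f] SpechtModule F' lam where
  toFun s := ⟨Finsupp.mapRange f (map_zero f) s.1, mapRange_mem_Specht f lam s.2⟩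
  map_add' s s' := Subtype.ext (Finsupp.mapRange_add (hf := map_zero f) (map_add f) s.1 s'.1)
  map_smul' a s := Subtype.ext
    (Finsupp.mapRange_smul' (hf := map_zero f) a (f a) s.1 fun b => f.map_mul a b)

theorem spechtMap_spechtRep (g : Equiv.Perm (Fin lam.card)) (s : SpechtModule F lam) :
    spechtMap f lam (spechtRep F lam g s) = spechtRep F' lam g (spechtMap f lam s) :=
  Subtype.ext (mapRange_tabloidRep f g s.1)

end Specht

/-! ### Scalars of central elements on cell modules, and their change of ground ring -/

namespace CellModule

variable {F F' : Type*} [CommRing F] [CommRing F'] {n : ℕ} {δ : F} {lam : YoungDiagram}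

instance : SMulCommClass (BrauerAlgebra F n δ) F (CellModule F n δ lam) where
  smul_comm a r x := (rep F n δ lam a).map_smul r x

/-- Central elements of the Brauer algebra act on cell modules as scalars. -/
theorem exists_central_smul {z : BrauerAlgebra F n δ} (hz : ∀ a, a * z = z * a)
    (lam : YoungDiagram) : ∃ c : F, ∀ x : CellModule F n δ lam, z • x = c • x := by
  obtain ⟨ζ, hζ, h⟩ := central_smul_tmul (lam := lam) hz
  obtain ⟨c, hc⟩ := exists_classFunction_smul F lam hζ
  refine ⟨c, fun x => ?_⟩
  have : rep F n δ lam z = c • (1 : Module.End F (CellModule F n δ lam)) :=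
    lin_ext fun v s => (h v s).trans (by rw [hc, map_smul]; rfl)
  rw [smul_def, this]
  rfl

/-- The semilinear map of cell modules induced by a homomorphism of the ground rings. -/
def baseChange (f : F →+* F') (n : ℕ) (δ : F) (lam : YoungDiagram) :
    CellModule F n δ lam →ₛₗ[f] CellModule F' n (f δ) lam where
  toFun x := Finsupp.mapRange (spechtMap f lam) (map_zero _) x
  map_add' x y := Finsupp.mapRange_add (map_add _) x y
  map_smul' a x := Finsupp.mapRange_smul' a (f a) x fun s => (spechtMap f lam).map_smulₛₗ a s

theorem baseChange_tmul (f : F →+* F') (v : PartialDiagram n lam.card) (s : SpechtModule F lam) :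
    baseChange f n δ lam (tmul δ v s) = tmul (f δ) v (spechtMap f lam s) :=
  Finsupp.mapRange_single (hf := map_zero (spechtMap f lam))

theorem baseChange_ofDiagram (f : F →+* F') (d : Diagram (Fin n) (Fin lam.card))
    (s : SpechtModule F lam) :
    baseChange f n δ lam (ofDiagram δ d s) = ofDiagram (f δ) d (spechtMap f lam s) := by
  rw [ofDiagram, ofDiagram]
  split_ifs with h
  · rw [baseChange_tmul, spechtMap_spechtRep]
  · rw [map_zero]

theorem baseChange_smul_tmul (f : F →+* F') (z : BrauerAlgebra F n δ)
    (v : PartialDiagram n lam.card) (s : SpechtModule F lam) :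
    baseChange f n δ lam (z • tmul δ v s) =
      BrauerAlgebra.baseChange f n δ z • tmul (f δ) v (spechtMap f lam s) := by
  rw [smul_tmul, smul_tmul, map_sum]
  refine Finset.sum_congr rfl fun d _ => ?_
  rw [LinearMap.map_smulₛₗ, baseChange_ofDiagram, BrauerAlgebra.baseChange_apply,
    BrauerAlgebra.leftCoeff_mapCoeff]

/-- A polytabloid as an element of the Specht module. -/
def spechtPolytabloid (F : Type*) [CommRing F] (t : Fin lam.card ≃ lam.cells) :
    SpechtModule F lam :=
  (⟨polytabloid F lam t, Submodule.subset_span ⟨t, rfl⟩⟩ : Specht F lam)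

/-- A pure tensor of a partial diagram and a polytabloid. -/
def basicElt (δ : F) (v : PartialDiagram n lam.card) (t : Fin lam.card ≃ lam.cells) :
    CellModule F n δ lam :=
  tmul δ v (spechtPolytabloid F t)

/-- The functional reading off the tabloid of `t` in the component of `v` takes the value `1` on
this element. Scalars are thus determined by their action, over any ground ring. -/
theorem eq_of_smul_basicElt (δ : F) (v : PartialDiagram n lam.card)
    (t : Fin lam.card ≃ lam.cells) {a b : F} (h : a • basicElt δ v t = b • basicElt δ v t) :
    a = b := by
  classical
  let π : SpechtModule F lam →ₗ[F] F := (Finsupp.lapply (tabloid lam t)).comp (Specht F lam).subtype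
  let ε : CellModule F n δ lam →ₗ[F] F := lin δ fun v' => if v' = v then π else 0
  have h1 : ε (basicElt δ v t) = 1 := by
    rw [basicElt, lin_tmul, if_pos rfl]
    exact polytabloid_apply_tabloid F lam t
  have h2 := congrArg ε h
  rwa [map_smul, map_smul, h1, smul_eq_mul, smul_eq_mul, mul_one, mul_one] at h2

/-- The scalars by which a central element acts are compatible with change of the ground ring. -/
theorem baseChange_smul_basicElt (f : F →+* F') {z : BrauerAlgebra F n δ} {c : F}
    (hc : ∀ x : CellModule F n δ lam, z • x = c • x) (v : PartialDiagram n lam.card)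
    (t : Fin lam.card ≃ lam.cells) : BrauerAlgebra.baseChange f n δ z • basicElt (f δ) v t =
      f c • basicElt (f δ) v t := by
  have h1 : spechtMap f lam (spechtPolytabloid F t) = spechtPolytabloid F' t :=
    Subtype.ext (mapRange_polytabloid f lam t)
  have h2 := baseChange_smul_tmul f z v (spechtPolytabloid F t)
  rw [hc, LinearMap.map_smulₛₗ, baseChange_tmul, h1] at h2
  exact h2.symm

end CellModule

/-- Needed for cell modules to be nonzero: a zero module would satisfy `LiesInBlock` for every
block. The `2t` remaining nodes are paired by exchanging two copies of `Fin t`. -/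
theorem Label.nonempty_partialDiagram {n : ℕ} (lam : Label n) :
    Nonempty (PartialDiagram n lam.1.card) := by
  obtain ⟨lam, t, ht⟩ := lam
  dsimp only
  let e : Fin lam.card ⊕ (Fin t ⊕ Fin t) ≃ Fin n := Fintype.equivFinOfCardEq (by simp; omega)
  let σ : Fin lam.card ⊕ (Fin t ⊕ Fin t) → Fin lam.card ⊕ (Fin t ⊕ Fin t) := Sum.map id Sum.swap
  refine ⟨⟨fun i => e (σ (e.symm i)), fun i => ?_, ?_⟩⟩
  · rw [e.symm_apply_apply]
    rcases h : e.symm i with j | j | j <;> simp [σ, ← h]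
  · refine Eq.trans ?_ (Finset.card_fin lam.card)
    symm
    refine Finset.card_bij (fun j _ => e (.inl j)) (by simp [σ]) ?_ ?_
    · intro i _ j _ h
      exact Sum.inl_injective (e.injective h)
    · intro i hi
      rw [Finset.mem_filter] at hi
      rcases h : e.symm i with j | j | j
      · exact ⟨j, Finset.mem_univ _, by rw [← h, e.apply_symm_apply]⟩
      all_goals
        exfalso
        have h1 := hi.2
        rw [h] at h1
        have h2 := congrArg e.symm h1
        rw [h] at h2
        simp [σ] at h2

end Brauer

end

/-! ### Comparison of the blocks over `K` and over `k` -/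

theorem mainTheorem4 {R : Type*} [CommRing R] [IsDomain R] [IsDiscreteValuationRing R]
    (K : Type*) [Field K] [Algebra R K] [IsFractionRing R K] [CharZero K]
    (p : ℕ) [Fact p.Prime] [CharP (IsLocalRing.ResidueField R) p]
    (δ : R) (n : ℕ) (lam mu : Brauer.Label n)
    (h : mu ∈ Brauer.blockSet K n (algebraMap R K δ) lam) :
    mu ∈ Brauer.blockSet (IsLocalRing.ResidueField R) n (IsLocalRing.residue R δ) lam := by
  obtain ⟨b, hb, hbl, hbm⟩ := h
  obtain ⟨v⟩ := Brauer.Label.nonempty_partialDiagram lam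
  obtain ⟨w⟩ := Brauer.Label.nonempty_partialDiagram mu
  let t : Fin lam.1.card ≃ lam.1.cells := lam.1.cells.equivFin.symm
  let u : Fin mu.1.card ≃ mu.1.cells := mu.1.cells.equivFin.symm
  set k := IsLocalRing.ResidueField R
  set f : R →+* k := IsLocalRing.residue R
  have hv : Brauer.CellModule.basicElt (f δ) v t ≠ 0 := fun h0 => one_ne_zero (α := k)
    (Brauer.CellModule.eq_of_smul_basicElt (f δ) v t (a := 1) (b := 0)
      (by rw [h0, smul_zero, smul_zero]))
  have hvK : Brauer.CellModule.basicElt (algebraMap R K δ) v t ≠ 0 := fun h0 => one_ne_zero (α := K)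
    (Brauer.CellModule.eq_of_smul_basicElt _ v t (a := 1) (b := 0)
      (by rw [h0, smul_zero, smul_zero]))
  have : Nontrivial (Brauer.CellModule k n (f δ) lam.1) := ⟨_, _, hv⟩
  obtain ⟨e, he, hel⟩ := Brauer.exists_liesInBlock k (A := Brauer.BrauerAlgebra k n (f δ))
      (Brauer.CellModule k n (f δ) lam.1) (by
    intro e hee hec
    obtain ⟨c, hc⟩ := Brauer.CellModule.exists_central_smul hec lam.1
    -- A central idempotent acts by an idempotent scalar of the field `k`, so by `0` or `1`.
    have hcc : c * c = c := Brauer.CellModule.eq_of_smul_basicElt (f δ) v t (by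
      rw [mul_smul, ← hc, ← hc, ← mul_smul, hee])
    rcases IsIdempotentElem.iff_eq_zero_or_one.1 hcc with rfl | rfl
    · exact .inl fun x => by rw [hc, zero_smul]
    · exact .inr fun x => by rw [hc, one_smul])
  refine ⟨e, he, hel, ?_⟩
  obtain ⟨ϖ, hϖ⟩ := IsDiscreteValuationRing.exists_irreducible R
  have hker : ∀ r, f r = 0 ↔ ϖ ∣ r := fun r => by
    rw [IsLocalRing.residue_eq_zero_iff, hϖ.maximalIdeal_eq, Ideal.mem_span_singleton]
  obtain ⟨z, hz, hze⟩ := Brauer.exists_central_lift (Brauer.BrauerAlgebra.baseChange f n δ)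
    (Brauer.BrauerAlgebra.baseChange_surjective IsLocalRing.residue_surjective) ϖ
    (Brauer.BrauerAlgebra.baseChange_eq_zero_iff hker) he.idem he.central
  obtain ⟨c, hc⟩ := Brauer.CellModule.exists_central_smul hz lam.1
  obtain ⟨d, hd⟩ := Brauer.CellModule.exists_central_smul hz mu.1
  have hcd : c = d := by
    apply IsFractionRing.injective R K
    set zK := Brauer.BrauerAlgebra.baseChange (algebraMap R K) n δ z with hzK
    have hl := Brauer.CellModule.baseChange_smul_basicElt (algebraMap R K) hc v t
    have hm := Brauer.CellModule.baseChange_smul_basicElt (algebraMap R K) hd w u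
    obtain ⟨cK, hcK⟩ : ∃ x, x = algebraMap R K c := ⟨_, rfl⟩
    obtain ⟨dK, hdK⟩ : ∃ x, x = algebraMap R K d := ⟨_, rfl⟩
    rw [← hcK] at hl ⊢
    rw [← hdK] at hm ⊢
    -- This central element kills a nonzero vector of the cell module of `λ`, so it is nilpotent on
    -- the block `b`; on the cell module of `μ` it is the scalar `dK - cK`.
    set y := zK - algebraMap K _ cK with hy
    have hyc : ∀ a, a * y = y * a := fun a => by
      rw [hy, mul_sub, sub_mul, Brauer.BrauerAlgebra.baseChange_central _ hz, Algebra.commutes]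
    obtain ⟨N, hN⟩ := hb.exists_pow_mul_eq_zero K hbl hvK hyc (by
      rw [hy, sub_smul, hl, algebraMap_smul, sub_self])
    have hpow : ∀ j : ℕ, y ^ j • Brauer.CellModule.basicElt (algebraMap R K δ) w u =
        (dK - cK) ^ j •
          Brauer.CellModule.basicElt (algebraMap R K δ) w u := by
      intro j
      induction j with
      | zero => rw [pow_zero, pow_zero, one_smul, one_smul]
      | succ j ih =>
        rw [pow_succ, mul_smul, hy, sub_smul, hm, algebraMap_smul, ← sub_smul, ← hy,
          smul_comm, ih, smul_smul, ← pow_succ']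
    have h0 := hpow N
    -- Inserting `b`, which is the identity on the cell module of `μ`, brings in `y ^ N * b = 0`.
    rw [← hbm (Brauer.CellModule.basicElt (algebraMap R K δ) w u), ← mul_smul, hN,
      zero_smul, hbm] at h0
    have h1 := Brauer.CellModule.eq_of_smul_basicElt _ w u (b := 0)
      (h0.symm.trans (zero_smul _ _).symm)
    exact (sub_eq_zero.1 (pow_eq_zero_iff' |>.1 h1 |>.1)).symm
  have hfc : f c = 1 := Brauer.CellModule.eq_of_smul_basicElt (f δ) v t (by
    rw [← Brauer.CellModule.baseChange_smul_basicElt f hc, hze, hel, one_smul])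
  obtain ⟨c', hc'⟩ := Brauer.CellModule.exists_central_smul he.central mu.1
  -- The scalar of `e` on the cell module of `μ` is the residue of `d = c`, which is `1`.
  have hc1 : c' = 1 := Brauer.CellModule.eq_of_smul_basicElt (f δ) w u (by
    rw [← hc', ← hze, Brauer.CellModule.baseChange_smul_basicElt f hd, ← hcd, hfc])
  intro x
  rw [hc', hc1, one_smul]
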